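/- Let $G$ be a finite simple undirected connected graph and let $s\neq t$ be vertices of $G$. An $(s,t)$-separator is a set $C\subseteq V(G)\setminus\{s,t\}$ such that $t$ is not reachable from $s$ in $G-C$; it is minimal if no proper subset of it is an $(s,t)$-separator. A sequence $(C_1,\dots,C_k)$ of minimal $(s,t)$-separators is an $(s,t)$-separator chain if the $C_j$ are pairwise disjoint and, for all $1\le j<j'\le k$, every vertex of $C_j$ is reachable from $s$ in $G-C_{j'}$ and every vertex of $C_{j'}$ is reachable from $t$ in $G-C_j$. **Theorem.** There is a deterministic algorithm that, given a finite simple connected graph $G$ on $n$ vertices, two different vertices $s,t\in V(G)$ and positive integers $p,q$, outputs one of the following structures in $G$: (a) an $(s,t)$-separator chain $(C_1,\dots,C_p)$ with $|C_j|\le 2q$ for each $j\in\{1,\dots,p\}$; or (b) a sequence $(P_1,\dots,P_q)$ of (not necessarily distinct) simple $(s,t)$-paths such that for each $i\in\{1,\dots,q\}$ $$\Bigl|\Bigl(V(P_i)\cap\bigcup_{i'\neq i}V(P_{i'})\Bigr)\setminus\{s,t\}\Bigr|\le 4p.$$ The algorithm runs in polynomial time: on a unit-cost random access machine over the natural numbers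 with addition and truncated subtraction (and no multiplication), its number of steps is bounded by a fixed polynomial in $n+\log p+q$. -/

import Mathlib

/-! ### Separators and paths in graphs -/

namespace SimpleGraph

variable {V : Type*}

/-- The set of vertices reachable from `u` in the graph `G - C` obtained from `G` by deleting
the vertices of `C` (empty if `u` itself is deleted). -/
def reachAvoiding (G : SimpleGraph V) (C : Set V) (u : V) : Set V :=
  {v | ∃ (hu : u ∈ Cᶜ) (hv : v ∈ Cᶜ), (G.induce Cᶜ).Reachable ⟨u, hu⟩ ⟨v, hv⟩}

/-- `C` is an `(s,t)`-separator: it avoids `s` and `t`, and `t` is not reachable from `s`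
in `G - C`. -/
def IsSTSeparator (G : SimpleGraph V) (s t : V) (C : Set V) : Prop :=
  s ∉ C ∧ t ∉ C ∧ t ∉ G.reachAvoiding C s

/-- `(C 0, …, C (k-1))` is an `(s,t)`-separator chain: pairwise disjoint (inclusion-wise) minimal
`(s,t)`-separators such that for `i < j` the set `C i` lies on the side of `s` of `C j` and
`C j` lies on the side of `t` of `C i`. -/
def IsSeparatorChain (G : SimpleGraph V) (s t : V) {k : ℕ} (C : Fin k → Set V) : Prop :=
  (∀ i, Minimal (G.IsSTSeparator s t) (C i)) ∧
  (∀ i j, i ≠ j → Disjoint (C i) (C j)) ∧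
  (∀ i j, i < j → C i ⊆ G.reachAvoiding (C j) s ∧ C j ⊆ G.reachAvoiding (C i) t)

/-- The internal vertices of the `i`-th path of a family of `(s,t)`-paths that lie on
at least one other path of the family. -/
def sharedInternalVertices {G : SimpleGraph V} {s t : V} {k : ℕ} (P : Fin k → G.Path s t)
    (i : Fin k) : Set V :=
  ({v | v ∈ (P i).1.support} ∩ ⋃ j ∈ {j : Fin k | j ≠ i}, {v | v ∈ (P j).1.support}) \ {s, t}

end SimpleGraph

/-! ### Random access machines

A unit-cost random access machine over the natural numbers, with addition and truncated
subtraction as the only arithmetic (no multiplication, so that numbers grow by only a constant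
number of bits per step), programmed by structured programs. -/

namespace RAM

/-- A memory state: registers `reg 0, reg 1, …` and arrays `mem 0, mem 1, …`, whose cells hold
natural numbers. A program mentions only finitely many registers and arrays, by name; cells of an
array are addressed by computed indices. -/
structure State where
  reg : ℕ → ℕ
  mem : ℕ → ℕ → ℕ

/-- Expressions. -/
inductive Expr where
  | const (c : ℕ)
  | reg (x : ℕ)
  | cell (a : ℕ) (i : Expr)
  | add (e₁ e₂ : Expr)
  | sub (e₁ e₂ : Expr)

/-- The value of an expression. -/
def Expr.eval (σ : State) : Expr → ℕ
  | .const c => c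
  | .reg x => σ.reg x
  | .cell a i => σ.mem a (i.eval σ)
  | .add e₁ e₂ => e₁.eval σ + e₂.eval σ
  | .sub e₁ e₂ => e₁.eval σ - e₂.eval σ

/-- The number of elementary operations needed to evaluate an expression. -/
def Expr.cost : Expr → ℕ
  | .const _ => 1
  | .reg _ => 1
  | .cell _ i => i.cost + 1
  | .add e₁ e₂ => e₁.cost + e₂.cost + 1
  | .sub e₁ e₂ => e₁.cost + e₂.cost + 1

/-- Programs. Tests succeed when the value of the expression is nonzero. -/
inductive Program where
  | skip
  | assign (x : ℕ) (e : Expr)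
  | store (a : ℕ) (i e : Expr)
  | seq (c₁ c₂ : Program)
  | ite (e : Expr) (c₁ c₂ : Program)
  | while (e : Expr) (c : Program)

/-- The state after writing `v` into register `x`. -/
def State.setReg (σ : State) (x v : ℕ) : State :=
  { σ with reg := Function.update σ.reg x v }

/-- The state after writing `v` into cell `i` of array `a`. -/
def State.setCell (σ : State) (a i v : ℕ) : State :=
  { σ with mem := Function.update σ.mem a (Function.update (σ.mem a) i v) }

/-- `Exec c σ k σ'`: the program `c`, started in the state `σ`, halts after exactly `k` steps,
in the state `σ'`. -/
inductive Exec : Program → State → ℕ → State → Prop where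
  | skip (σ : State) : Exec .skip σ 1 σ
  | assign (σ : State) (x : ℕ) (e : Expr) :
      Exec (.assign x e) σ (e.cost + 1) (σ.setReg x (e.eval σ))
  | store (σ : State) (a : ℕ) (i e : Expr) :
      Exec (.store a i e) σ (i.cost + e.cost + 1) (σ.setCell a (i.eval σ) (e.eval σ))
  | seq {c₁ c₂ : Program} {σ σ' σ'' : State} {k l : ℕ} :
      Exec c₁ σ k σ' → Exec c₂ σ' l σ'' → Exec (.seq c₁ c₂) σ (k + l) σ''
  | ite_true {e : Expr} {c₁ c₂ : Program} {σ σ' : State} {k : ℕ} :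
      e.eval σ ≠ 0 → Exec c₁ σ k σ' → Exec (.ite e c₁ c₂) σ (e.cost + 1 + k) σ'
  | ite_false {e : Expr} {c₁ c₂ : Program} {σ σ' : State} {k : ℕ} :
      e.eval σ = 0 → Exec c₂ σ k σ' → Exec (.ite e c₁ c₂) σ (e.cost + 1 + k) σ'
  | while_true {e : Expr} {c : Program} {σ σ' σ'' : State} {k l : ℕ} :
      e.eval σ ≠ 0 → Exec c σ k σ' → Exec (.while e c) σ' l σ'' →
      Exec (.while e c) σ (e.cost + 1 + k + l) σ''
  | while_false {e : Expr} {c : Program} {σ : State} :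
      e.eval σ = 0 → Exec (.while e c) σ (e.cost + 1) σ

end RAM

/-! ### Input and output of the algorithm -/

namespace SeparatorPathDuality

open Classical in
/-- The initial state for the input `(G, s, t, p, q)`: registers `0, …, 4` hold `n, s, t, p, q`,
and array `0` holds the adjacency matrix of `G`, row by row (the entry for `(u, v)` is in the cell
`u * n + v`). Everything else is `0`. -/
noncomputable def input {n : ℕ} (G : SimpleGraph (Fin n)) (s t : Fin n) (p q : ℕ) : RAM.State where
  reg x :=
    match x with
    | 0 => n
    | 1 => s
    | 2 => t
    | 3 => p
    | 4 => q
    | _ => 0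
  mem a k :=
    if a = 0 ∧ ∃ u v : Fin n, G.Adj u v ∧ k = (u : ℕ) * n + v then 1 else 0

open Classical in
/-- The final state `σ` presents the sets `C 0, …, C (p-1)`: register `0` holds `0`, and array `1`
holds the characteristic vectors of the sets one after another. -/
def OutputsSets {n p : ℕ} (σ : RAM.State) (C : Fin p → Finset (Fin n)) : Prop :=
  σ.reg 0 = 0 ∧
  ∀ (j : Fin p) (v : Fin n), σ.mem 1 ((j : ℕ) * n + v) = if v ∈ C j then 1 else 0

/-- The final state `σ` presents the paths `P 0, …, P (q-1)`: register `0` holds `1`, cell `i` of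
array `2` holds the length of `P i`, and the cells of array `1` from `i * n` on list
the vertices of `P i` from `s` to `t` (a path has at most `n` vertices). -/
def OutputsPaths {n q : ℕ} {G : SimpleGraph (Fin n)} {s t : Fin n} (σ : RAM.State)
    (P : Fin q → G.Path s t) : Prop :=
  σ.reg 0 = 1 ∧
  ∀ i : Fin q, σ.mem 2 i = (P i).1.length ∧
    ∀ k ≤ (P i).1.length, σ.mem 1 ((i : ℕ) * n + k) = ((P i).1.getVert k : ℕ)

end SeparatorPathDuality

/-!
A primal-dual algorithm for minimum cost flows proves the theorem, even with the bounds `q` and `p`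
instead of `2 * q` and `4 * p`.

Every vertex `v` is split into an in-node `v` and an out-node `v + n`. The first unit of flow
through a vertex is free, and every further unit has cost `1`. The algorithm maintains an integral
flow `F` from the out-node of `s` to the in-node of `t`, and potentials `π` that are `0` at the
source and satisfy the optimality conditions `IsPotential`: every residual arc has nonnegative
reduced cost. In each step it searches the residual arcs of reduced cost zero from the source. If
the sink is reached, then it pushes one unit of flow along the path (`IsPotential.push_adm`);
otherwise it raises the potentials of all nodes that were not reached by one
(`IsPotential.raise`). It stops when the flow has value `q` or `π t` is `min p n`.

If `π t` has reached the bound, then for `i < π t` the vertices at which `π` rises from `i` to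
`i + 1` between the in-node and the out-node form an `(s,t)`-separator, the `i`-th layer. Only its
vertices carry flow across the cut of the split graph at height `i`, and each of them carries some,
so that the layer has at most as many vertices as the value of the flow
(`IsPotential.card_layer_le`). The layers are disjoint, and none of them is met by a search from `s`
before an earlier one is passed. Keeping in each layer only the vertices that are discovered from
`s`, and then among these the ones that are discovered from `t`, makes them minimal separators that
form a chain (`SimpleGraph.isSeparatorChain_trim`). Since there are `π t + 1` different potentials
of out-nodes, `π t < n` (`IsPotential.lt_card`); so the bound `min p n` is `p` in this case.

If the flow has value `q`, then it is decomposed into `q` paths. A vertex on two of the paths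
carries at least two units of flow, which forces `π` to rise there. Since `π` does not decrease
along a path that carries flow, every path has at most `π t ≤ p` such vertices
(`IsPotential.ncard_le`).

For the running time, the algorithm is written in a language `RAM.Cmd` whose only loops are counting
loops. Its commands compute explicit state transformations, and the number of steps has a polynomial
bound which is read off from the structure of the command (`RAM.Cmd.exec_compile`), as all loops run
up to one of the numbers `n`, `2n`, `q`, `min p n` and `2n + q`.
-/

/-! ### Programs with bounded loops -/

namespace RAM

/-- Boolean negation of an expression. -/
def Expr.bNot (e : Expr) : Expr := .sub (.const 1) e

/-- Conjunction of two tests. -/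
def Expr.bAnd (e f : Expr) : Expr := .sub (.const 1) (.add (.sub (.const 1) e) (.sub (.const 1) f))

/-- Test for `e ≤ f`. -/
def Expr.bLe (e f : Expr) : Expr := .sub (.const 1) (.sub e f)

/-- Test for equality. -/
def Expr.bEq (e f : Expr) : Expr := .sub (.const 1) (.add (.sub e f) (.sub f e))

/-- The test `e` succeeds in the state `σ`. Disjunction of tests is `Expr.add`, and `e < f` is
the test `Expr.sub f e`. -/
def Expr.holds (σ : State) (e : Expr) : Prop := e.eval σ ≠ 0

instance (σ : State) (e : Expr) : Decidable (e.holds σ) := inferInstanceAs (Decidable (_ ≠ _))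

section holds

variable {σ : State} {e f : Expr}

@[simp] lemma Expr.holds_bNot : (Expr.bNot e).holds σ ↔ ¬ e.holds σ := by
  simp only [Expr.holds, Expr.bNot, Expr.eval]; omega

@[simp] lemma Expr.holds_bAnd : (Expr.bAnd e f).holds σ ↔ e.holds σ ∧ f.holds σ := by
  simp only [Expr.holds, Expr.bAnd, Expr.eval]; omega

@[simp] lemma Expr.holds_add : (Expr.add e f).holds σ ↔ e.holds σ ∨ f.holds σ := by
  simp only [Expr.holds, Expr.eval]; omega

@[simp] lemma Expr.holds_sub : (Expr.sub e f).holds σ ↔ f.eval σ < e.eval σ := by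
  simp only [Expr.holds, Expr.eval]; omega

@[simp] lemma Expr.holds_bLe : (Expr.bLe e f).holds σ ↔ e.eval σ ≤ f.eval σ := by
  simp only [Expr.holds, Expr.bLe, Expr.eval]; omega

@[simp] lemma Expr.holds_bEq : (Expr.bEq e f).holds σ ↔ e.eval σ = f.eval σ := by
  simp only [Expr.holds, Expr.bEq, Expr.eval]; omega

@[simp] lemma Expr.holds_cell {a : ℕ} : (Expr.cell a e).holds σ ↔ σ.mem a (e.eval σ) ≠ 0 :=
  Iff.rfl

/-- A conjunction always evaluates to `0` or `1`. -/
lemma Expr.eval_bAnd : (Expr.bAnd e f).eval σ = if e.holds σ ∧ f.holds σ then 1 else 0 := by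
  by_cases he : e.eval σ = 0 <;> by_cases hf : f.eval σ = 0 <;>
    simp [Expr.holds, Expr.bAnd, Expr.eval, he, hf]
  omega

end holds

namespace State

variable (σ : State) (x y v a b i j : ℕ)

@[simp] lemma setReg_reg : (σ.setReg x v).reg y = if y = x then v else σ.reg y := by
  simp [setReg, Function.update_apply]

@[simp] lemma setReg_mem : (σ.setReg x v).mem = σ.mem := rfl

@[simp] lemma setCell_reg : (σ.setCell a i v).reg = σ.reg := rfl

@[simp] lemma setCell_mem : (σ.setCell a i v).mem b =
    if b = a then Function.update (σ.mem a) i v else σ.mem b := by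
  by_cases h : b = a
  · subst h; simp [setCell]
  · simp [setCell, h]

end State

/-- Structured programs whose only loops are counting loops: `loop x b c` runs `c` with the
register `x` equal to `0, 1, …, m - 1`, where `m` is the content of the register `b`. -/
inductive Cmd where
  | skip
  | assign (x : ℕ) (e : Expr)
  | store (a : ℕ) (i e : Expr)
  | seq (c₁ c₂ : Cmd)
  | ite (e : Expr) (c₁ c₂ : Cmd)
  | loop (x b : ℕ) (c : Cmd)

/-- `iter f m σ` applies `f 0`, …, `f (m - 1)` to `σ`, in this order. -/
def iter (f : ℕ → State → State) : ℕ → State → State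
  | 0, σ => σ
  | m + 1, σ => f m (iter f m σ)

namespace Cmd

/-- The machine program of a command. -/
def compile : Cmd → Program
  | skip => .skip
  | assign x e => .assign x e
  | store a i e => .store a i e
  | seq c d => .seq c.compile d.compile
  | ite e c d => .ite e c.compile d.compile
  | loop x b c => .seq (.assign x (.const 0)) (.while (.sub (.reg b) (.reg x))
      (.seq c.compile (.assign x (.add (.reg x) (.const 1)))))

/-- The state transformation computed by the program of a command, provided that no loop body
writes to the counter or to the bound of its loop. -/
def sem : Cmd → State → State
  | skip, σ => σ
  | assign x e, σ => σ.setReg x (e.eval σ)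
  | store a i e, σ => σ.setCell a (i.eval σ) (e.eval σ)
  | seq c d, σ => d.sem (c.sem σ)
  | ite e c d, σ => if e.holds σ then c.sem σ else d.sem σ
  | loop x b c, σ => (iter (fun i τ => c.sem (τ.setReg x i)) (σ.reg b) σ).setReg x (σ.reg b)

/-- The registers to which a command may write. -/
def wregs : Cmd → List ℕ
  | skip => []
  | assign x _ => [x]
  | store _ _ _ => []
  | seq c d => c.wregs ++ d.wregs
  | ite _ c d => c.wregs ++ d.wregs
  | loop x _ c => x :: c.wregs

/-- The arrays to which a command may write. -/
def wmems : Cmd → List ℕ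
  | skip => []
  | assign _ _ => []
  | store a _ _ => [a]
  | seq c d => c.wmems ++ d.wmems
  | ite _ c d => c.wmems ++ d.wmems
  | loop _ _ c => c.wmems

lemma sem_seq (c d : Cmd) (σ : State) : (seq c d).sem σ = d.sem (c.sem σ) := rfl

lemma iter_invariant {f : ℕ → State → State} {σ : State} (I : ℕ → State → Prop) (h0 : I 0 σ)
    (m : ℕ) (hI : ∀ i < m, ∀ τ, I i τ → I (i + 1) (f i τ)) : I m (iter f m σ) := by
  induction m with
  | zero => exact h0
  | succ m ih => exact hI m (by omega) _ (ih fun i hi => hI i (by omega))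

lemma sem_reg {c : Cmd} {σ : State} {y : ℕ} (h : y ∉ c.wregs) : (c.sem σ).reg y = σ.reg y := by
  induction c generalizing σ with
  | skip => rfl
  | assign x e => simp [wregs] at h; simp [sem, h]
  | store a i e => rfl
  | seq c d ihc ihd => simp [wregs] at h; simp [sem, ihc h.1, ihd h.2]
  | ite e c d ihc ihd => simp [wregs] at h; simp only [sem]; split_ifs <;> simp [ihc h.1, ihd h.2]
  | loop x b c ih =>
    simp [wregs] at h
    simp only [sem, State.setReg_reg, h.1, if_false]
    refine iter_invariant (fun _ τ => τ.reg y = σ.reg y) rfl _ fun i _ τ hτ => ?_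
    rw [ih h.2]; simp [h.1, hτ]

lemma sem_mem {c : Cmd} {σ : State} {a : ℕ} (h : a ∉ c.wmems) : (c.sem σ).mem a = σ.mem a := by
  induction c generalizing σ with
  | skip => rfl
  | assign x e => rfl
  | store b i e => simp [wmems] at h; simp [sem, h]
  | seq c d ihc ihd => simp [wmems] at h; simp [sem, ihc h.1, ihd h.2]
  | ite e c d ihc ihd => simp [wmems] at h; simp only [sem]; split_ifs <;> simp [ihc h.1, ihd h.2]
  | loop x b c ih =>
    simp only [wmems] at h
    simp only [sem, State.setReg_mem]
    refine iter_invariant (fun _ τ => τ.mem a = σ.mem a) rfl _ fun i _ τ hτ => ?_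
    rw [ih h]; simp [hτ]

/-- `τ` agrees with `σ` on everything to which `c` does not write. -/
def Frame (c : Cmd) (σ τ : State) : Prop :=
  (∀ y, y ∉ c.wregs → τ.reg y = σ.reg y) ∧ ∀ a, a ∉ c.wmems → τ.mem a = σ.mem a

lemma frame_sem (c : Cmd) (σ : State) : c.Frame σ (c.sem σ) :=
  ⟨fun _ => sem_reg, fun _ => sem_mem⟩

/-- The invariant rule for loops. The invariant only has to speak about what the loop changes,
because the step may use that everything else is as in the beginning. -/
lemma loop_rule {x b m : ℕ} {c : Cmd} {σ : State} (I : ℕ → State → Prop) (hm : σ.reg b = m)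
    (h0 : I 0 σ)
    (hI : ∀ i < m, ∀ τ, (loop x b c).Frame σ τ → I i τ → I (i + 1) (c.sem (τ.setReg x i))) :
    ∃ τ, I m τ ∧ (loop x b c).Frame σ τ ∧ (loop x b c).sem σ = τ.setReg x m := by
  have key := iter_invariant (f := fun i τ => c.sem (τ.setReg x i)) (σ := σ)
    (fun i τ => I i τ ∧ (loop x b c).Frame σ τ) ⟨h0, fun _ _ => rfl, fun _ _ => rfl⟩ m
    (fun i hi τ hτ => ⟨hI i hi τ hτ.2 hτ.1, fun y hy => by
      simp only [wregs, List.mem_cons, not_or] at hy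
      rw [sem_reg hy.2, State.setReg_reg, if_neg hy.1]
      exact hτ.2.1 y (by simp [wregs, hy]), fun a ha => by
      rw [sem_mem (by simpa [wmems] using ha)]
      exact hτ.2.2 a ha⟩)
  exact ⟨_, key.1, key.2, by simp only [sem, hm]⟩

/-- `R` contains the bounds of all loops of the command, the command does not write to a register
in `R`, and no loop body writes to the counter of its loop. -/
def Bounded (R : List ℕ) : Cmd → Bool
  | skip => true
  | assign x _ => decide (x ∉ R)
  | store _ _ _ => true
  | seq c d => c.Bounded R && d.Bounded R
  | ite _ c d => c.Bounded R && d.Bounded R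
  | loop x b c => decide (b ∈ R) && decide (x ∉ R) && decide (x ∉ c.wregs) && c.Bounded R

/-- A bound for the running time, as a polynomial in a bound for the number of iterations of the
loops. The constants of a loop are the costs of setting, testing and increasing the counter: `8` for
every round, and `6` for the initialization and the last test. -/
noncomputable def time : Cmd → Polynomial ℕ
  | skip => 1
  | assign _ e => (e.cost + 1 : ℕ)
  | store _ i e => (i.cost + e.cost + 1 : ℕ)
  | seq c d => c.time + d.time
  | ite e c d => (e.cost + 1 : ℕ) + c.time + d.time
  | loop _ _ c => 6 + Polynomial.X * (c.time + 8)

lemma not_mem_wregs_of_bounded {R : List ℕ} {c : Cmd} (h : c.Bounded R) {y : ℕ} (hy : y ∈ R) :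
    y ∉ c.wregs := by
  induction c with
  | skip => simp [wregs]
  | assign x e => simp [Bounded] at h; simp only [wregs, List.mem_singleton]; rintro rfl; exact h hy
  | store a i e => simp [wregs]
  | seq c d ihc ihd => simp [Bounded] at h; simp [wregs, ihc h.1, ihd h.2]
  | ite e c d ihc ihd => simp [Bounded] at h; simp [wregs, ihc h.1, ihd h.2]
  | loop x b c ih =>
    simp [Bounded] at h
    simp only [wregs, List.mem_cons, not_or]
    exact ⟨by rintro rfl; exact h.1.1.2 hy, ih h.2⟩

/-- The program of a command computes its state transformation, within the time bound. -/
theorem exec_compile {R : List ℕ} {B : ℕ} {c : Cmd} (h : c.Bounded R) {σ : State}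
    (hB : ∀ b ∈ R, σ.reg b ≤ B) :
    ∃ k ≤ c.time.eval B, Exec c.compile σ k (c.sem σ) := by
  induction c generalizing σ with
  | skip => exact ⟨1, by simp [time], .skip σ⟩
  | assign x e => exact ⟨_, by simp [time], .assign σ x e⟩
  | store a i e => exact ⟨_, by simp [time], .store σ a i e⟩
  | seq c d ihc ihd =>
    simp [Bounded] at h
    obtain ⟨k, hk, h1⟩ := ihc h.1 hB
    obtain ⟨l, hl, h2⟩ := ihd h.2 (σ := c.sem σ) (fun b hb => by
      rw [sem_reg (not_mem_wregs_of_bounded h.1 hb)]; exact hB b hb)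
    exact ⟨k + l, by simp only [time, Polynomial.eval_add]; omega, .seq h1 h2⟩
  | ite e c d ihc ihd =>
    simp [Bounded] at h
    by_cases he : e.holds σ
    · obtain ⟨k, hk, h1⟩ := ihc h.1 hB
      refine ⟨_, ?_, by rw [sem, if_pos he]; exact .ite_true he h1⟩
      simp only [time, Polynomial.eval_add, Polynomial.eval_natCast, Nat.cast_id]; omega
    · obtain ⟨k, hk, h1⟩ := ihd h.2 hB
      refine ⟨_, ?_, by rw [sem, if_neg he]; exact .ite_false (not_not.1 he) h1⟩
      simp only [time, Polynomial.eval_add, Polynomial.eval_natCast, Nat.cast_id]; omega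
  | loop x b c ih =>
    simp [Bounded] at h
    obtain ⟨⟨⟨hb, hx⟩, hxc⟩, hc⟩ := h
    set τ : ℕ → State := fun i => iter (fun i τ => c.sem (τ.setReg x i)) i σ with hτ
    have hreg : ∀ i, ∀ y ∈ R, (τ i).reg y = σ.reg y := fun i y hy => by
      refine iter_invariant (fun _ τ => τ.reg y = σ.reg y) rfl _ fun i _ τ hτ => ?_
      rw [sem_reg (not_mem_wregs_of_bounded hc hy)]
      have : y ≠ x := by rintro rfl; exact hx hy
      simp [this, hτ]
    have hne : b ≠ x := by rintro rfl; exact hx hb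
    -- the `while` loop, entered with counter `m - j`, makes `j` more rounds
    have key : ∀ j ≤ σ.reg b, ∃ k ≤ 4 + j * (c.time.eval B + 8),
        Exec (.while (.sub (.reg b) (.reg x))
          (.seq c.compile (.assign x (.add (.reg x) (.const 1)))))
          ((τ (σ.reg b - j)).setReg x (σ.reg b - j)) k ((τ (σ.reg b)).setReg x (σ.reg b)) := by
      intro j
      induction j with
      | zero =>
        intro _
        exact ⟨_, by simp [Expr.cost], .while_false (by simp [Expr.eval, hne, hreg _ b hb])⟩
      | succ j ihj =>
        intro hj
        obtain ⟨l, hl, h2⟩ := ihj (by omega)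
        obtain ⟨k, hk, h1⟩ := ih hc (σ := (τ (σ.reg b - (j + 1))).setReg x (σ.reg b - (j + 1)))
          (fun y hy => by
            have : y ≠ x := by rintro rfl; exact hx hy
            simpa [this, hreg _ y hy] using hB y hy)
        have hstep : c.sem ((τ (σ.reg b - (j + 1))).setReg x (σ.reg b - (j + 1))) =
            τ (σ.reg b - j) := by
          have : σ.reg b - j = σ.reg b - (j + 1) + 1 := by omega
          rw [this]; rfl
        have h3 := Exec.assign (c.sem ((τ (σ.reg b - (j + 1))).setReg x (σ.reg b - (j + 1)))) x
          (.add (.reg x) (.const 1))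
        have hval : (Expr.add (.reg x) (.const 1)).eval
            (c.sem ((τ (σ.reg b - (j + 1))).setReg x (σ.reg b - (j + 1)))) = σ.reg b - j := by
          simp only [Expr.eval]
          rw [sem_reg hxc]
          simp; omega
        rw [hval, hstep] at h3
        rw [hstep] at h1
        refine ⟨_, ?_, .while_true ?_ (.seq h1 h3) h2⟩
        · simp only [Expr.cost]
          have : (j + 1) * (c.time.eval B + 8) = j * (c.time.eval B + 8) + (c.time.eval B + 8) := by
            ring
          omega
        · simp [Expr.eval, hne, hreg _ b hb]; omega
    obtain ⟨k, hk, h1⟩ := key _ le_rfl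
    rw [Nat.sub_self] at h1
    refine ⟨_, ?_, .seq (.assign σ x (.const 0)) h1⟩
    have hmul := Nat.mul_le_mul_right (c.time.eval B + 8) (hB b hb)
    simp only [time, Polynomial.eval_add, Polynomial.eval_mul, Polynomial.eval_X,
      Polynomial.eval_ofNat, Expr.cost]
    omega

end Cmd

end RAM

/-! ### Graph search on the machine

Conventions for all commands below. Register `8` holds the value of the flow, `9` the potential of
`t`, `13` the root of a search, `14` the current node and `17` the next node of a walk in a search
tree, `16` the address and `15` the number of the recorded vertices; `10` is an accumulator, and the
registers `11`, `12`, `20`, …, `24` are loop counters. Array `4` holds the flow, `5` the potentials,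
`6` the matrix of the relation to be searched, `7` the levels and `8` the predecessors in the search
tree, and `9` a set of vertices. Matrices on the nodes of the split graph have row length `2n`. -/

namespace SeparatorPathDuality

open RAM

/-- What the main part of the algorithm never changes. The registers `0, 1, 2, 4, 5, 6, 7` hold
`n`, `s`, `t`, `q`, `2n`, `p'` and `2n + q`, where `p'` is the bound for the potential of `t`;
array `0` holds the adjacency relation `A`, and array `3` holds the multiples of `n`. -/
structure Setup (n s t q p' : ℕ) (A : ℕ → ℕ → Prop) (σ : State) : Prop where
  r0 : σ.reg 0 = n
  r1 : σ.reg 1 = s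
  r2 : σ.reg 2 = t
  r4 : σ.reg 4 = q
  r5 : σ.reg 5 = 2 * n
  r6 : σ.reg 6 = p'
  r7 : σ.reg 7 = 2 * n + q
  adj : ∀ u < n, ∀ v < n, (σ.mem 0 (u * n + v) ≠ 0 ↔ A u v)
  row : ∀ a < 2 * n + q, σ.mem 3 a = a * n

section Setup

variable {n s t q p' : ℕ} {A : ℕ → ℕ → Prop} {σ τ : State}

lemma Setup.congr (h : Setup n s t q p' A σ) (hr : ∀ y ∈ [0, 1, 2, 4, 5, 6, 7], τ.reg y = σ.reg y)
    (h0 : τ.mem 0 = σ.mem 0) (h3 : τ.mem 3 = σ.mem 3) : Setup n s t q p' A τ where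
  r0 := by rw [hr 0 (by decide), h.r0]
  r1 := by rw [hr 1 (by decide), h.r1]
  r2 := by rw [hr 2 (by decide), h.r2]
  r4 := by rw [hr 4 (by decide), h.r4]
  r5 := by rw [hr 5 (by decide), h.r5]
  r6 := by rw [hr 6 (by decide), h.r6]
  r7 := by rw [hr 7 (by decide), h.r7]
  adj := by rw [h0]; exact h.adj
  row := by rw [h3]; exact h.row

/-- The command writes neither to a register nor to an array which `Setup` mentions. -/
def Preserves (c : Cmd) : Prop :=
  (∀ y ∈ [0, 1, 2, 4, 5, 6, 7], y ∉ c.wregs) ∧ 0 ∉ c.wmems ∧ 3 ∉ c.wmems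

instance (c : Cmd) : Decidable (Preserves c) := inferInstanceAs (Decidable (_ ∧ _))

lemma Setup.frame (h : Setup n s t q p' A σ) {c : Cmd} (hc : Preserves c) (hf : c.Frame σ τ) :
    Setup n s t q p' A τ :=
  h.congr (fun y hy => hf.1 y (hc.1 y hy)) (hf.2 0 hc.2.1) (hf.2 3 hc.2.2)

lemma Setup.setReg (h : Setup n s t q p' A σ) {x v : ℕ} (hx : x ∉ [0, 1, 2, 4, 5, 6, 7]) :
    Setup n s t q p' A (σ.setReg x v) :=
  h.congr (fun y hy => by
    rw [State.setReg_reg, if_neg]; rintro rfl; exact hx hy) rfl rfl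

end Setup

/-- The address of the entry `(a, b)` of a square matrix with `2n` rows. -/
def pos (n a b : ℕ) : ℕ := a * n + a * n + b

lemma pos_inj {n a b a' b' : ℕ} (hb : b < 2 * n) (hb' : b' < 2 * n) :
    pos n a b = pos n a' b' ↔ a = a' ∧ b = b' := by
  constructor
  · intro h
    have h1 : pos n a b / (2 * n) = a := by
      rw [pos, show a * n + a * n + b = b + 2 * n * a by ring,
        Nat.add_mul_div_left _ _ (by omega), Nat.div_eq_of_lt hb, zero_add]
    have h2 : pos n a' b' / (2 * n) = a' := by
      rw [pos, show a' * n + a' * n + b' = b' + 2 * n * a' by ring,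
        Nat.add_mul_div_left _ _ (by omega), Nat.div_eq_of_lt hb', zero_add]
    have ha : a = a' := by rw [← h1, ← h2, h]
    subst ha
    simp only [pos] at h
    exact ⟨rfl, by omega⟩
  · rintro ⟨rfl, rfl⟩; rfl

/-- The expression for `pos`. -/
def posE (a b : Expr) : Expr := .add (.add (.cell 3 a) (.cell 3 a)) b

lemma Setup.eval_posE {n s t q p' : ℕ} {A : ℕ → ℕ → Prop} {σ : State}
    (h : Setup n s t q p' A σ) {a b : Expr} (ha : a.eval σ < 2 * n) :
    (posE a b).eval σ = pos n (a.eval σ) (b.eval σ) := by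
  simp only [posE, Expr.eval, pos]
  rw [h.row _ (by omega)]

/-- Computes in array `6` the matrix of the relation that `e` expresses in terms of the registers
`20` and `21`. -/
def fill (e : Expr) : Cmd :=
  .loop 20 5 (.loop 21 5 (.store 6 (posE (.reg 20) (.reg 21)) e))

lemma sem_fill {n s t q p' : ℕ} {A : ℕ → ℕ → Prop} {σ : State} (h : Setup n s t q p' A σ)
    {e : Expr} {R : ℕ → ℕ → Prop}
    (he : ∀ τ : State, Setup n s t q p' A τ → (∀ a, a ≠ 6 → τ.mem a = σ.mem a) →
      ∀ a < 2 * n, ∀ b < 2 * n, τ.reg 20 = a → τ.reg 21 = b → (e.holds τ ↔ R a b)) :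
    ∀ a < 2 * n, ∀ b < 2 * n, (((fill e).sem σ).mem 6 (pos n a b) ≠ 0 ↔ R a b) := by
  have hp : ∀ e, Preserves (fill e) ∧
      Preserves (.loop 21 5 (.store 6 (posE (.reg 20) (.reg 21)) e)) := by
    intro e; simp [Preserves, fill, Cmd.wregs, Cmd.wmems]
  have hm : ∀ e, ∀ a, a ≠ 6 → a ∉ (fill e).wmems ∧
      a ∉ (Cmd.loop 21 5 (.store 6 (posE (.reg 20) (.reg 21)) e)).wmems := by
    intro e; simp [fill, Cmd.wmems]
  obtain ⟨τ, hτ, -, hs⟩ := Cmd.loop_rule (x := 20) (b := 5)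
    (c := .loop 21 5 (.store 6 (posE (.reg 20) (.reg 21)) e)) (σ := σ)
    (fun i τ => ∀ a < i, ∀ b < 2 * n, (τ.mem 6 (pos n a b) ≠ 0 ↔ R a b)) h.r5
    (by simp) (by
      intro i hi τ hf hI
      have hSτ := (h.frame (hp e).1 hf).setReg (x := 20) (v := i) (by decide)
      obtain ⟨ρ, hρ, -, hs⟩ := Cmd.loop_rule (x := 21) (b := 5)
        (c := .store 6 (posE (.reg 20) (.reg 21)) e) (σ := τ.setReg 20 i)
        (fun j ρ => ∀ a < 2 * n, ∀ b < 2 * n, a < i ∨ (a = i ∧ b < j) →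
          (ρ.mem 6 (pos n a b) ≠ 0 ↔ R a b)) hSτ.r5
        (by
          intro a _ b hb hab
          exact hI a (by omega) b hb) (by
          intro j hj ρ hg hJ a ha b hb hab
          have hSρ := (hSτ.frame (hp e).2 hg).setReg (x := 21) (v := j) (by decide)
          have h20 : ρ.reg 20 = i := by
            rw [hg.1 20 (by simp [Cmd.wregs])]; simp
          have heval : (posE (.reg 20) (.reg 21)).eval (ρ.setReg 21 j) = pos n i j := by
            rw [hSρ.eval_posE (by simp [Expr.eval, h20, hi])]; simp [Expr.eval, h20]
          have hR := he (ρ.setReg 21 j) hSρ (fun c hc => by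
            simp only [State.setReg_mem]
            rw [hg.2 c (hm e c hc).2, State.setReg_mem, hf.2 c (hm e c hc).1]) i hi j hj
            (by simp [h20]) (by simp)
          simp only [Cmd.sem, State.setCell_mem, if_true, heval, State.setReg_mem,
            Function.update_apply, pos_inj hb hj]
          split_ifs with hc
          · rw [hc.1, hc.2]; exact hR
          · exact hJ a ha b hb (by omega))
      intro a ha b hb
      rw [hs]
      exact hρ a (by omega) b hb (by omega))
  intro a ha b hb
  rw [fill, hs]
  exact hτ a ha b hb

/-- The result of a breadth-first search from `root` in the relation `M` on `{0, …, W - 1}`: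
`mark x` is `0` if `x` was not reached, and one more than the distance of `x` from `root`
otherwise; `par x` is the predecessor of `x`. -/
structure SearchTree (M : ℕ → ℕ → Prop) (W root : ℕ) (mark par : ℕ → ℕ) : Prop where
  root_lt : root < W
  mark_root : mark root = 1
  eq_root : ∀ x < W, mark x = 1 → x = root
  parent : ∀ x < W, 2 ≤ mark x → par x < W ∧ mark (par x) + 1 = mark x ∧ M (par x) x
  closed : ∀ u < W, ∀ v < W, mark u ≠ 0 → M u v → mark v ≠ 0
  mark_le : ∀ x < W, mark x ≤ W

/-- The invariant of the search in round `r`, when the pairs before `(u, v)` are done. -/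
structure SearchInv (M : ℕ → ℕ → Prop) (W root r u v : ℕ) (mark par : ℕ → ℕ) : Prop where
  root_lt : root < W
  mark_root : mark root = 1
  eq_root : ∀ x < W, mark x = 1 → x = root
  parent : ∀ x < W, 2 ≤ mark x → par x < W ∧ mark (par x) + 1 = mark x ∧ M (par x) x
  old : ∀ a < W, ∀ b < W, mark a ≠ 0 → mark a ≤ r → M a b → mark b ≠ 0
  current : ∀ a < W, ∀ b < W, a < u ∨ (a = u ∧ b < v) → mark a = r + 1 → M a b → mark b ≠ 0

section Search

variable {M : ℕ → ℕ → Prop} {W root r u v : ℕ} {mark par : ℕ → ℕ}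

lemma SearchInv.skip (h : SearchInv M W root r u v mark par)
    (hn : ¬ (mark u = r + 1 ∧ M u v ∧ mark v = 0)) :
    SearchInv M W root r u (v + 1) mark par where
  __ := h
  current a ha b hb hab h1 h2 h3 := by
    by_cases hc : a = u ∧ b = v
    · obtain ⟨rfl, rfl⟩ := hc; exact hn ⟨h1, h2, h3⟩
    · exact h.current a ha b hb (by omega) h1 h2 h3

lemma SearchInv.visit (h : SearchInv M W root r u v mark par) (hu : u < W)
    (h1 : mark u = r + 1) (h2 : M u v) (h3 : mark v = 0) :
    SearchInv M W root r u (v + 1) (Function.update mark v (r + 2)) (Function.update par v u) where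
  root_lt := h.root_lt
  mark_root := by
    have : root ≠ v := by rintro rfl; have := h.mark_root; omega
    rw [Function.update_of_ne this, h.mark_root]
  eq_root x hx hx1 := by
    by_cases hxv : x = v
    · subst hxv; simp at hx1
    · rw [Function.update_of_ne hxv] at hx1; exact h.eq_root x hx hx1
  parent x hx hx2 := by
    by_cases hxv : x = v
    · subst hxv
      have : u ≠ x := by rintro rfl; omega
      simp [Function.update_of_ne this, h1, h2, hu]
    · rw [Function.update_of_ne hxv] at hx2 ⊢
      obtain ⟨h4, h5, h6⟩ := h.parent x hx hx2
      rw [Function.update_of_ne hxv]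
      have : par x ≠ v := by intro h7; rw [h7] at h5; omega
      rw [Function.update_of_ne this]
      exact ⟨h4, h5, h6⟩
  old a ha b hb h4 h5 h6 := by
    by_cases hav : a = v
    · subst hav; simp at h5
    · rw [Function.update_of_ne hav] at h4 h5
      by_cases hbv : b = v
      · subst hbv; simp
      · rw [Function.update_of_ne hbv]; exact h.old a ha b hb h4 h5 h6
  current a ha b hb hab h5 h6 := by
    by_cases hav : a = v
    · subst hav; simp at h5
    · rw [Function.update_of_ne hav] at h5
      by_cases hbv : b = v
      · subst hbv; simp
      · rw [Function.update_of_ne hbv]; exact h.current a ha b hb (by omega) h5 h6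

lemma SearchInv.nextRow (h : SearchInv M W root r u W mark par) :
    SearchInv M W root r (u + 1) 0 mark par where
  __ := h
  current a ha b hb hab := h.current a ha b hb (by omega)

lemma SearchInv.nextRound (h : SearchInv M W root r W 0 mark par) :
    SearchInv M W root (r + 1) 0 0 mark par where
  __ := h
  old a ha b hb h1 h2 h3 := by
    by_cases h4 : mark a = r + 1
    · exact h.current a ha b hb (by omega) h4 h3
    · exact h.old a ha b hb h1 (by omega) h3
  current a ha b hb hab := by omega

/-- Every level up to the level of a reached element is inhabited, so there are at most `W`
levels, and the search is complete after `W` rounds. -/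
lemma SearchInv.searchTree (h : SearchInv M W root W 0 0 mark par) :
    SearchTree M W root mark par := by
  have level : ∀ k x, x < W → mark x = k → ∀ j, 1 ≤ j → j ≤ k → ∃ y < W, mark y = j := by
    intro k
    induction k with
    | zero => intro x _ _ j h1 h2; omega
    | succ k ih =>
      intro x hx hk j h1 h2
      rcases Nat.lt_or_ge k j with hj | hj
      · exact ⟨x, hx, by omega⟩
      · obtain ⟨h3, h4, -⟩ := h.parent x hx (by omega)
        exact ih (par x) h3 (by omega) j h1 hj
  have hle : ∀ x < W, mark x ≤ W := by
    intro x hx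
    have hsub : Finset.Icc 1 (mark x) ⊆ (Finset.range W).image mark := by
      intro j hj
      rw [Finset.mem_Icc] at hj
      obtain ⟨y, hy, hyj⟩ := level _ x hx rfl j hj.1 hj.2
      exact Finset.mem_image.2 ⟨y, Finset.mem_range.2 hy, hyj⟩
    simpa using (Finset.card_le_card hsub).trans Finset.card_image_le
  exact { h with
    closed := fun a ha b hb h1 h2 => h.old a ha b hb h1 (hle a ha) h2
    mark_le := hle }

/-- The elements that a search reaches are those that are reachable from the root. -/
lemma SearchTree.mark_ne_zero_iff (h : SearchTree M W root mark par) {x : ℕ} (hx : x < W) :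
    mark x ≠ 0 ↔ Relation.ReflTransGen (fun a b => b < W ∧ M a b) root x := by
  constructor
  · have key : ∀ k x, x < W → mark x = k + 1 →
        Relation.ReflTransGen (fun a b => b < W ∧ M a b) root x := by
      intro k
      induction k with
      | zero => intro x hx h1; rw [h.eq_root x hx h1]
      | succ k ih =>
        intro x hx h1
        obtain ⟨h2, h3, h4⟩ := h.parent x hx (by omega)
        exact (ih _ h2 (by omega)).tail ⟨hx, h4⟩
    intro h0
    exact key (mark x - 1) x hx (by omega)
  · intro hr
    have : x < W ∧ mark x ≠ 0 := by
      induction hr with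
      | refl => exact ⟨hx, by rw [h.mark_root]; omega⟩
      | tail _ h2 ih =>
        rename_i b c hbc
        have hb : b < W ∧ mark b ≠ 0 := by
          rcases Relation.ReflTransGen.cases_tail hbc with h3 | ⟨d, _, h3⟩
          · subst h3; exact ⟨h.root_lt, by rw [h.mark_root]; omega⟩
          · exact ih h3.1
        exact ⟨hx, h.closed b hb.1 c hx hb.2 h2.2⟩
    exact this.2

end Search

/-- Round `r` of the search treats the pair `(u, v)`, where `r`, `u` and `v` are in the
registers `22`, `23` and `24`. -/
def findStep : Cmd :=
  .ite
    (.bAnd (.bEq (.cell 7 (.reg 23)) (.add (.reg 22) (.const 1)))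
      (.bAnd (.cell 6 (posE (.reg 23) (.reg 24))) (.bNot (.cell 7 (.reg 24)))))
    (.seq (.store 7 (.reg 24) (.add (.reg 22) (.const 2))) (.store 8 (.reg 24) (.reg 23)))
    .skip

/-- Breadth-first search from register `13` in the relation in array `6`; array `7` receives the
levels, and array `8` the predecessors. -/
def find : Cmd :=
  .seq (.loop 24 5 (.store 7 (.reg 24) (.const 0)))
  (.seq (.store 7 (.reg 13) (.const 1))
  (.loop 22 5 (.loop 23 5 (.loop 24 5 findStep))))

lemma sem_find {n s t q p' : ℕ} {A : ℕ → ℕ → Prop} {σ : State} (h : Setup n s t q p' A σ)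
    {R : ℕ → ℕ → Prop} (hR : ∀ a < 2 * n, ∀ b < 2 * n, (σ.mem 6 (pos n a b) ≠ 0 ↔ R a b))
    {root : ℕ} (hroot : σ.reg 13 = root) (hlt : root < 2 * n) :
    SearchTree R (2 * n) root ((find.sem σ).mem 7) ((find.sem σ).mem 8) := by
  obtain ⟨τ, hτ, hfτ, hs⟩ := Cmd.loop_rule (x := 24) (b := 5)
    (c := .store 7 (.reg 24) (.const 0)) (σ := σ)
    (fun i τ => ∀ a < i, τ.mem 7 a = 0) h.r5 (by simp) (by
      intro i hi τ _ hI a ha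
      simp only [Cmd.sem, State.setCell_mem, if_true, State.setReg_mem, Function.update_apply,
        Expr.eval, State.setReg_reg]
      split_ifs with hc
      · rfl
      · exact hI a (by omega))
  rw [find, Cmd.sem, hs, Cmd.sem]
  set σ₁ := (Cmd.store 7 (.reg 13) (.const 1)).sem (τ.setReg 24 (2 * n)) with hσ₁
  have hS₁ : Setup n s t q p' A σ₁ :=
    ((h.frame (by decide) hfτ).setReg (by decide)).frame
      (by decide) (Cmd.frame_sem _ _)
  have h6 : σ₁.mem 6 = σ.mem 6 := by
    rw [hσ₁, Cmd.sem_mem (by decide), State.setReg_mem, hfτ.2 6 (by decide)]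
  have h13 : τ.reg 13 = root := by rw [hfτ.1 13 (by decide), hroot]
  have h7 : ∀ x, σ₁.mem 7 x = if x = root then 1 else τ.mem 7 x := by
    intro x
    simp [hσ₁, Cmd.sem, Expr.eval, Function.update_apply, h13]
  have hinit : SearchInv R (2 * n) root 0 0 0 (σ₁.mem 7) (σ₁.mem 8) := by
    refine ⟨hlt, by simp [h7], fun x hx h1 => ?_, fun x hx h2 => ?_,
      fun a _ b _ h1 h2 => by omega, fun a _ b _ hab => by omega⟩
    · by_contra hne
      rw [h7, if_neg hne, hτ x hx] at h1; omega
    · rw [h7] at h2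
      split_ifs at h2
      · omega
      · rw [hτ x hx] at h2; omega
  obtain ⟨ρ, hρ, -, hs⟩ := Cmd.loop_rule (x := 22) (b := 5)
    (c := .loop 23 5 (.loop 24 5 findStep)) (σ := σ₁)
    (fun r τ => SearchInv R (2 * n) root r 0 0 (τ.mem 7) (τ.mem 8)) hS₁.r5 hinit (by
      intro r hr τ₂ hf₂ hI₂
      have hS₂ := (hS₁.frame (by decide) hf₂).setReg
        (x := 22) (v := r) (by decide)
      obtain ⟨ρ, hρ, -, hs⟩ := Cmd.loop_rule (x := 23) (b := 5)
        (c := .loop 24 5 findStep) (σ := τ₂.setReg 22 r)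
        (fun u τ => SearchInv R (2 * n) root r u 0 (τ.mem 7) (τ.mem 8)) hS₂.r5 hI₂ (by
          intro u hu τ₃ hf₃ hI₃
          have hS₃ := (hS₂.frame (by decide) hf₃).setReg
            (x := 23) (v := u) (by decide)
          have h22 : τ₃.reg 22 = r := by
            rw [hf₃.1 22 (by decide)]; simp
          obtain ⟨ρ, hρ, -, hs⟩ := Cmd.loop_rule (x := 24) (b := 5)
            (c := findStep) (σ := τ₃.setReg 23 u)
            (fun v τ => SearchInv R (2 * n) root r u v (τ.mem 7) (τ.mem 8)) hS₃.r5 hI₃ (by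
              intro v hv τ₄ hf₄ hI₄
              have hS₄ := (hS₃.frame (by decide) hf₄).setReg
                (x := 24) (v := v) (by decide)
              have h22' : τ₄.reg 22 = r := by
                rw [hf₄.1 22 (by decide)]; simp [h22]
              have h23' : τ₄.reg 23 = u := by
                rw [hf₄.1 23 (by decide)]; simp
              have h6' : τ₄.mem 6 = σ.mem 6 := by
                rw [hf₄.2 6 (by decide), State.setReg_mem, hf₃.2 6 (by decide),
                  State.setReg_mem, hf₂.2 6 (by decide), h6]
              have hpos : (posE (.reg 23) (.reg 24)).eval (τ₄.setReg 24 v) = pos n u v := by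
                rw [hS₄.eval_posE (by simp [Expr.eval, h23', hu])]; simp [Expr.eval, h23']
              have hcond : (Expr.bAnd (.bEq (.cell 7 (.reg 23)) (.add (.reg 22) (.const 1)))
                  (.bAnd (.cell 6 (posE (.reg 23) (.reg 24)))
                    (.bNot (.cell 7 (.reg 24))))).holds (τ₄.setReg 24 v) ↔
                  τ₄.mem 7 u = r + 1 ∧ R u v ∧ τ₄.mem 7 v = 0 := by
                simp only [Expr.holds_bAnd, Expr.holds_bEq, Expr.holds_cell, Expr.holds_bNot,
                  hpos, State.setReg_mem, h6', hR u hu v hv]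
                simp [Expr.eval, h22', h23']
              rw [findStep, Cmd.sem]
              split_ifs with hc
              · rw [hcond] at hc
                have := hI₄.visit hu hc.1 hc.2.1 hc.2.2
                simpa [Cmd.sem, Expr.eval, h22', h23'] using this
              · rw [hcond] at hc
                exact hI₄.skip hc)
          rw [hs]
          exact hρ.nextRow)
      rw [hs]
      exact hρ.nextRound)
  rw [hs]
  exact hρ.searchTree

/-- Searches from the value of `r` in the relation that `e` expresses. -/
def search (e r : Expr) : Cmd := .seq (fill e) (.seq (.assign 13 r) find)

lemma not_mem_wregs_search {e r : Expr} {y : ℕ} (h : y ∉ [13, 20, 21, 22, 23, 24]) :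
    y ∉ (search e r).wregs := by
  simp only [List.mem_cons, not_or] at h
  simp [search, fill, find, findStep, Cmd.wregs, h]

lemma not_mem_wmems_search {e r : Expr} {a : ℕ} (h : a ∉ [6, 7, 8]) :
    a ∉ (search e r).wmems := by
  simp only [List.mem_cons, not_or] at h
  simp [search, fill, find, findStep, Cmd.wmems, h]

lemma Setup.search {n s t q p' : ℕ} {A : ℕ → ℕ → Prop} {σ : State} (h : Setup n s t q p' A σ)
    (e r : Expr) : Setup n s t q p' A ((search e r).sem σ) :=
  h.frame ⟨fun y hy => not_mem_wregs_search (by revert y; decide),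
    not_mem_wmems_search (by decide), not_mem_wmems_search (by decide)⟩ (Cmd.frame_sem _ _)

lemma sem_search {n s t q p' : ℕ} {A : ℕ → ℕ → Prop} {σ : State} (h : Setup n s t q p' A σ)
    {e r : Expr} {R : ℕ → ℕ → Prop}
    (he : ∀ τ : State, Setup n s t q p' A τ → (∀ a, a ≠ 6 → τ.mem a = σ.mem a) →
      ∀ a < 2 * n, ∀ b < 2 * n, τ.reg 20 = a → τ.reg 21 = b → (e.holds τ ↔ R a b))
    {root : ℕ} (hr : ∀ τ : State, Setup n s t q p' A τ → r.eval τ = root)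
    (hlt : root < 2 * n) :
    SearchTree R (2 * n) root (((search e r).sem σ).mem 7) (((search e r).sem σ).mem 8) ∧
      ((search e r).sem σ).reg 13 = root := by
  have hS : Setup n s t q p' A ((fill e).sem σ) :=
    h.frame (c := fill e) (by simp [Preserves, fill, Cmd.wregs, Cmd.wmems]) (Cmd.frame_sem _ _)
  have hM := sem_fill h he
  have h13 : ((Cmd.assign 13 r).sem ((fill e).sem σ)).reg 13 = root := by
    simp [Cmd.sem, hr _ hS]
  refine ⟨sem_find (hS.setReg (x := 13) (v := r.eval ((fill e).sem σ)) (by decide)) hM h13 hlt, ?_⟩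
  rw [search, Cmd.sem, Cmd.sem, Cmd.sem_reg (by decide), h13]

/-! ### Pushing flow along a path -/

/-- The flow obtained from `F` by sending one more unit from `x` to `y`: flow in the opposite
direction is cancelled if there is any. -/
def push (F : ℕ → ℕ → ℕ) (x y : ℕ) : ℕ → ℕ → ℕ := fun a b =>
  if F y x ≠ 0 then if a = y ∧ b = x then F a b - 1 else F a b
  else if a = x ∧ b = y then F a b + 1 else F a b

/-- Records the vertex of the node in register `14` in array `1` if it is an out-node. -/
def recordStep : Cmd :=
  .ite (.bLe (.reg 0) (.reg 14))
    (.seq (.store 1 (.add (.reg 16) (.reg 15)) (.sub (.reg 14) (.reg 0)))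
      (.assign 15 (.add (.reg 15) (.const 1))))
    .skip

/-- Pushes one unit of flow in array `4` from register `17` to register `14`. -/
def pushStep : Cmd :=
  .ite (.cell 4 (posE (.reg 14) (.reg 17)))
    (.store 4 (posE (.reg 14) (.reg 17)) (.sub (.cell 4 (posE (.reg 14) (.reg 17))) (.const 1)))
    (.store 4 (posE (.reg 17) (.reg 14)) (.add (.cell 4 (posE (.reg 17) (.reg 14))) (.const 1)))

/-- Moves register `14` one step towards the root of the search tree. -/
def followStep : Cmd :=
  .ite (.bNot (.bEq (.reg 14) (.reg 13)))
    (.seq (.assign 17 (.cell 8 (.reg 14)))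
      (.seq recordStep (.seq pushStep (.assign 14 (.reg 17)))))
    .skip

/-- Walks from the node in register `14` to the root of the search tree, pushes one unit of flow
back along this path, and records the vertices of the out-nodes on it. As no level exceeds `2n`, the
root is reached within `2n` rounds. -/
def follow : Cmd := .loop 22 5 followStep

lemma recordStep_reg (σ : State) : (recordStep.sem σ).reg 15 =
    if σ.reg 0 ≤ σ.reg 14 then σ.reg 15 + 1 else σ.reg 15 := by
  simp only [recordStep, Cmd.sem, Expr.holds_bLe, Expr.eval]
  split_ifs <;> simp

lemma recordStep_mem (σ : State) : (recordStep.sem σ).mem 1 =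
    if σ.reg 0 ≤ σ.reg 14 then
      Function.update (σ.mem 1) (σ.reg 16 + σ.reg 15) (σ.reg 14 - σ.reg 0)
    else σ.mem 1 := by
  simp only [recordStep, Cmd.sem, Expr.holds_bLe, Expr.eval]
  split_ifs <;> simp

section

variable {n s t q p' : ℕ} {A : ℕ → ℕ → Prop} {σ : State}

lemma sem_pushStep (h : Setup n s t q p' A σ) {F : ℕ → ℕ → ℕ}
    (hF : ∀ a < 2 * n, ∀ b < 2 * n, σ.mem 4 (pos n a b) = F a b) {x y : ℕ} (hx : σ.reg 17 = x)
    (hy : σ.reg 14 = y) (hxn : x < 2 * n) (hyn : y < 2 * n) :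
    ∀ a < 2 * n, ∀ b < 2 * n, (pushStep.sem σ).mem 4 (pos n a b) = push F x y a b := by
  intro a ha b hb
  have h1 : (posE (.reg 14) (.reg 17)).eval σ = pos n y x := by
    rw [h.eval_posE (by simpa [Expr.eval, hy] using hyn)]; simp [Expr.eval, hx, hy]
  have h2 : (posE (.reg 17) (.reg 14)).eval σ = pos n x y := by
    rw [h.eval_posE (by simpa [Expr.eval, hx] using hxn)]; simp [Expr.eval, hx, hy]
  simp only [pushStep, Cmd.sem, Expr.holds_cell, h1, h2, hF y hyn x hxn, push]
  split_ifs with h3 h4 h4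
  · obtain ⟨rfl, rfl⟩ := h4
    simp [Expr.eval, h1, hF a ha b hb]
  · simp only [State.setCell_mem, if_true, Function.update_apply, pos_inj hb hxn, if_neg h4,
      hF a ha b hb]
  · obtain ⟨rfl, rfl⟩ := h4
    simp [Expr.eval, h2, hF a ha b hb]
  · simp only [State.setCell_mem, if_true, Function.update_apply, pos_inj hb hyn, if_neg h4,
      hF a ha b hb]

/-- A relation between the current node, the flow, the number of recorded vertices and the array
of recorded vertices holds at the end of the walk if it holds at the beginning and is preserved
by every step. -/
lemma sem_follow (h : Setup n s t q p' A σ) {R : ℕ → ℕ → Prop} {root start base : ℕ}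
    {mark par : ℕ → ℕ} (hpar : σ.mem 8 = par)
    (T : SearchTree R (2 * n) root mark par) (h13 : σ.reg 13 = root) (h14 : σ.reg 14 = start)
    (hstart : start < 2 * n) (hreach : mark start ≠ 0) (h16 : σ.reg 16 = base) {F : ℕ → ℕ → ℕ}
    (hF : ∀ a < 2 * n, ∀ b < 2 * n, σ.mem 4 (pos n a b) = F a b)
    (J : ℕ → (ℕ → ℕ → ℕ) → ℕ → (ℕ → ℕ) → Prop) (h0 : J start F (σ.reg 15) (σ.mem 1))
    (hJ : ∀ y F len out, y < 2 * n → mark y ≠ 0 → y ≠ root → par y < 2 * n →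
      mark (par y) + 1 = mark y → R (par y) y → J y F len out →
      J (par y) (push F (par y) y) (if n ≤ y then len + 1 else len)
        (if n ≤ y then Function.update out (base + len) (y - n) else out)) :
    ∃ F', J root F' ((follow.sem σ).reg 15) ((follow.sem σ).mem 1) ∧
      ∀ a < 2 * n, ∀ b < 2 * n, (follow.sem σ).mem 4 (pos n a b) = F' a b := by
  obtain ⟨τ, hτ, -, hs⟩ := Cmd.loop_rule (x := 22) (b := 5) (c := followStep) (σ := σ)
    (fun k τ => ∃ y F', τ.reg 14 = y ∧ y < 2 * n ∧ mark y ≠ 0 ∧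
      (y = root ∨ mark y + k ≤ 2 * n) ∧ J y F' (τ.reg 15) (τ.mem 1) ∧
      ∀ a < 2 * n, ∀ b < 2 * n, τ.mem 4 (pos n a b) = F' a b) h.r5
    ⟨start, F, h14, hstart, hreach, Or.inr (T.mark_le _ hstart), h0, hF⟩ (by
      rintro k hk τ hf ⟨y, F', hy, hyn, hym, hyk, hJy, hF'⟩
      have hS := (h.frame (by decide) hf).setReg (x := 22) (v := k) (by decide)
      set ρ := τ.setReg 22 k with hρ
      have e13 : ρ.reg 13 = root := by simp [hρ, hf.1 13 (by decide), h13]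
      have e16 : ρ.reg 16 = base := by simp [hρ, hf.1 16 (by decide), h16]
      have e14 : ρ.reg 14 = y := by simp [hρ, hy]
      have e8 : ρ.mem 8 = par := by simp [hρ, hf.2 8 (by decide), hpar]
      have hJρ : J y F' (ρ.reg 15) (ρ.mem 1) := by simpa [hρ] using hJy
      have hFρ : ∀ a < 2 * n, ∀ b < 2 * n, ρ.mem 4 (pos n a b) = F' a b := by
        simpa [hρ] using hF'
      clear_value ρ
      simp only [followStep, Cmd.sem, Expr.holds_bNot, Expr.holds_bEq]
      simp only [Expr.eval, e14, e13, e8]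
      by_cases hr : y = root
      · rw [if_neg (by simpa using hr)]
        exact ⟨y, F', e14, hyn, hym, Or.inl hr, hJρ, hFρ⟩
      · rw [if_pos hr]
        have hm1 : mark y ≠ 1 := fun h1 => hr (T.eq_root y hyn h1)
        obtain ⟨h1, h2, h3⟩ := T.parent y hyn (by omega)
        have hJ' := hJ y F' (ρ.reg 15) (ρ.mem 1) hyn hym hr h1 h2 h3 hJρ
        obtain ⟨ρ₁, hρ₁⟩ : ∃ ρ₁, ρ₁ = ρ.setReg 17 (par y) := ⟨_, rfl⟩
        have hS₁ : Setup n s t q p' A ρ₁ := by rw [hρ₁]; exact hS.setReg (by decide)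
        have d0 : ρ₁.reg 0 = n := hS₁.r0
        have d14 : ρ₁.reg 14 = y := by simp [hρ₁, e14]
        have d15 : ρ₁.reg 15 = ρ.reg 15 := by simp [hρ₁]
        have d16 : ρ₁.reg 16 = base := by simp [hρ₁, e16]
        have d17 : ρ₁.reg 17 = par y := by simp [hρ₁]
        have dm : ρ₁.mem = ρ.mem := by simp [hρ₁]
        rw [← hρ₁]
        clear hρ₁
        obtain ⟨ρ₂, hρ₂⟩ : ∃ ρ₂, ρ₂ = recordStep.sem ρ₁ := ⟨_, rfl⟩
        have hS₂ : Setup n s t q p' A ρ₂ := by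
          rw [hρ₂]; exact hS₁.frame (by decide) (Cmd.frame_sem _ _)
        have c17 : ρ₂.reg 17 = par y := by rw [hρ₂, Cmd.sem_reg (by decide), d17]
        have c14 : ρ₂.reg 14 = y := by rw [hρ₂, Cmd.sem_reg (by decide), d14]
        have c4 : ρ₂.mem 4 = ρ.mem 4 := by rw [hρ₂, Cmd.sem_mem (by decide), dm]
        have c15 : ρ₂.reg 15 = if n ≤ y then ρ.reg 15 + 1 else ρ.reg 15 := by
          rw [hρ₂, recordStep_reg, d0, d14, d15]
        have c1 : ρ₂.mem 1 =
            if n ≤ y then Function.update (ρ.mem 1) (base + ρ.reg 15) (y - n) else ρ.mem 1 := by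
          rw [hρ₂, recordStep_mem, d0, d14, d15, d16, dm]
        rw [← c15, ← c1] at hJ'
        rw [← hρ₂]
        clear hρ₂
        refine ⟨par y, push F' (par y) y, ?_, h1, by omega, by omega, ?_, ?_⟩
        · rw [State.setReg_reg, if_pos rfl, Cmd.sem_reg (by decide), c17]
        · rw [State.setReg_reg, if_neg (by decide), State.setReg_mem,
            Cmd.sem_reg (by decide), Cmd.sem_mem (by decide)]
          exact hJ'
        · exact sem_pushStep hS₂ (F := F') (by rw [c4]; exact hFρ) c17 c14 h1 hyn)
  obtain ⟨y, F', -, hyn, hym, hyk, hJy, hF'⟩ := hτ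
  have hyr : y = root := by omega
  subst hyr
  rw [follow, hs]
  exact ⟨F', by simpa using hJy, hF'⟩

end

end SeparatorPathDuality

/-! ### Flows in the split graph -/

namespace SeparatorPathDuality

/-- The arcs of the split graph of the relation `A` on `{0, …, n - 1}`. The vertex `v` is split
into the in-node `v` and the out-node `v + n`, joined by an arc; an edge `u v` becomes an arc from
the out-node of `u` to the in-node of `v`. -/
def Arc (n : ℕ) (A : ℕ → ℕ → Prop) (a b : ℕ) : Prop :=
  (∃ u v, A u v ∧ a = u + n ∧ b = v) ∨ (a < n ∧ b = a + n)

/-- The net amount of flow into the node `a`. -/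
def net (n : ℕ) (F : ℕ → ℕ → ℕ) (a : ℕ) : ℤ := ∑ b ∈ Finset.range (2 * n), ((F b a : ℤ) - F a b)

/-- `F` is a flow of value `val` from the out-node of `s` to the in-node of `t`. -/
structure IsFlow (n : ℕ) (A : ℕ → ℕ → Prop) (s t : ℕ) (val : ℤ) (F : ℕ → ℕ → ℕ) : Prop where
  arc : ∀ a b, F a b ≠ 0 → Arc n A a b
  net_eq : ∀ a < 2 * n, net n F a =
    val * ((if a = t then 1 else 0) - (if a = s + n then 1 else 0))

/-- The optimality conditions for the flow `F` and the potential `π`, when a unit of flow through a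
vertex is free if it is the only one, and every further unit has cost `1`: the reduced cost of
every residual arc is nonnegative. -/
structure IsPotential (n : ℕ) (A : ℕ → ℕ → Prop) (F : ℕ → ℕ → ℕ) (π : ℕ → ℕ) : Prop where
  edge : ∀ u v, A u v → π v ≤ π (u + n)
  edge_flow : ∀ u v, A u v → F (u + n) v ≠ 0 → π (u + n) ≤ π v
  vertex : ∀ v < n, π (v + n) ≤ π v + 1
  vertex_zero : ∀ v < n, F v (v + n) = 0 → π (v + n) ≤ π v
  vertex_one : ∀ v < n, 1 ≤ F v (v + n) → π v ≤ π (v + n)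
  vertex_two : ∀ v < n, 2 ≤ F v (v + n) → π v + 1 ≤ π (v + n)

/-- The residual arcs with reduced cost zero. -/
def Adm (n : ℕ) (A : ℕ → ℕ → Prop) (F : ℕ → ℕ → ℕ) (π : ℕ → ℕ) (a b : ℕ) : Prop :=
  (∃ u v, A u v ∧ a = u + n ∧ b = v ∧ π v = π (u + n)) ∨
  (∃ u v, A u v ∧ a = v ∧ b = u + n ∧ F (u + n) v ≠ 0) ∨
  (a < n ∧ b = a + n ∧ ((F a b = 0 ∧ π b = π a) ∨ (F a b ≠ 0 ∧ π b = π a + 1))) ∨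
  (b < n ∧ a = b + n ∧ F b a ≠ 0 ∧ (F b a = 1 → π a = π b))

section

variable {n s t : ℕ} {A : ℕ → ℕ → Prop} {val : ℤ} {F : ℕ → ℕ → ℕ} {π : ℕ → ℕ}

lemma net_push {x y : ℕ} (hx : x < 2 * n) (hy : y < 2 * n) (hxy : x ≠ y) (a : ℕ) :
    net n (push F x y) a =
      net n F a + (if a = y then 1 else 0) - (if a = x then 1 else 0) := by
  have h : ∀ b, ((push F x y b a : ℤ) - push F x y a b) = ((F b a : ℤ) - F a b) +
      (if b = x then (if a = y then 1 else 0) else 0) -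
      (if b = y then (if a = x then 1 else 0) else 0) := by
    intro b
    simp only [push]
    by_cases h0 : F y x ≠ 0
    · simp only [if_pos h0]
      split_ifs <;> grind
    · simp only [if_neg h0]
      split_ifs <;> grind
  simp only [net, h, Finset.sum_sub_distrib, Finset.sum_add_distrib, Finset.sum_ite_eq',
    Finset.mem_range, hx, hy, if_true]

lemma push_apply_of_ne {x y a b : ℕ} (h : ¬ (a = x ∧ b = y)) (h' : ¬ (a = y ∧ b = x)) :
    push F x y a b = F a b := by
  simp only [push]; split_ifs <;> rfl

/-- The flow across a cut. -/
lemma sum_net (X : Finset ℕ) (hX : X ⊆ Finset.range (2 * n)) :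
    ∑ a ∈ X, net n F a =
      ∑ a ∈ X, ∑ b ∈ Finset.range (2 * n) \ X, ((F b a : ℤ) - F a b) := by
  have h1 : ∀ a, net n F a = ∑ b ∈ Finset.range (2 * n) \ X, ((F b a : ℤ) - F a b) +
      ∑ b ∈ X, ((F b a : ℤ) - F a b) := fun a => (Finset.sum_sdiff hX).symm
  have h2 : ∑ a ∈ X, ∑ b ∈ X, ((F b a : ℤ) - F a b) = 0 := by
    simp only [Finset.sum_sub_distrib]
    rw [Finset.sum_comm]; simp
  simp only [h1, Finset.sum_add_distrib, h2, add_zero]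

/-- A set of nodes that contains the sink, but not the source, has the value of the flow as its net
inflow. -/
lemma IsFlow.cut (hF : IsFlow n A s t val F) (X : Finset ℕ) (hX : X ⊆ Finset.range (2 * n))
    (ht : t ∈ X) (hs : s + n ∉ X) :
    val = ∑ a ∈ X, ∑ b ∈ Finset.range (2 * n) \ X, ((F b a : ℤ) - F a b) := by
  rw [← sum_net X hX, Finset.sum_congr rfl fun a ha => hF.net_eq a (Finset.mem_range.1 (hX ha)),
    ← Finset.mul_sum, Finset.sum_sub_distrib]
  simp [ht, hs]

/-- If the flow has positive value, then the sink is reachable from the source in its support. -/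
lemma IsFlow.source_mem (hF : IsFlow n A s t val F) (hval : 0 < val) (X : Finset ℕ)
    (hX : X ⊆ Finset.range (2 * n)) (ht : t ∈ X)
    (hcl : ∀ a ∈ X, ∀ b < 2 * n, F b a ≠ 0 → b ∈ X) : s + n ∈ X := by
  by_contra hs
  have h1 := hF.cut X hX ht hs
  have h2 : ∑ a ∈ X, ∑ b ∈ Finset.range (2 * n) \ X, ((F b a : ℤ) - F a b) ≤ 0 := by
    refine Finset.sum_nonpos fun a ha => Finset.sum_nonpos fun b hb => ?_
    rw [Finset.mem_sdiff, Finset.mem_range] at hb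
    have : F b a = 0 := by
      by_contra h0; exact hb.2 (hcl a ha b hb.1 h0)
    omega
  omega

variable (hA : ∀ u v, A u v → u < n ∧ v < n ∧ u ≠ v)

include hA

/-- Pushing along an admissible arc preserves the optimality conditions. -/
lemma IsPotential.push_adm (h : IsPotential n A F π)
    (hs : ∀ a b, F a b ≠ 0 → Arc n A a b) {x y : ℕ} (hxy : Adm n A F π x y) :
    IsPotential n A (push F x y) π ∧ ∀ a b, push F x y a b ≠ 0 → Arc n A a b := by
  have hedge : ∀ u v, A u v → F v (u + n) = 0 := by
    intro u v huv
    by_contra h0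
    have h1 := hA u v huv
    rcases hs _ _ h0 with ⟨u', v', h2, h3, h4⟩ | ⟨h2, h3⟩ <;> omega
  have hvert : ∀ v < n, F (v + n) v = 0 := by
    intro v hv
    by_contra h0
    rcases hs _ _ h0 with ⟨u', v', h2, h3, h4⟩ | ⟨h2, h3⟩
    · have h1 := hA u' v' h2; omega
    · omega
  rcases hxy with ⟨u, v, huv, rfl, rfl, hπ⟩ | ⟨u, v, huv, rfl, rfl, hf⟩ |
    ⟨hx, rfl, hf⟩ | ⟨hy, rfl, hf, hf'⟩
  · have h0 := hedge u y huv
    have h1 := hA u y huv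
    have hp : ∀ a b, push F (u + n) y a b =
        if a = u + n ∧ b = y then F a b + 1 else F a b := by
      intro a b; simp [push, h0]
    have hv : ∀ w < n, push F (u + n) y w (w + n) = F w (w + n) := by
      intro w hw; rw [hp, if_neg (by omega)]
    refine ⟨⟨h.edge, fun a b hab h2 => ?_, h.vertex, fun w hw => ?_, fun w hw => ?_,
      fun w hw => ?_⟩, fun a b h2 => ?_⟩
    · rw [hp] at h2
      split_ifs at h2 with h3
      · rw [h3.1, h3.2, hπ]
      · exact h.edge_flow a b hab h2
    · rw [hv w hw]; exact h.vertex_zero w hw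
    · rw [hv w hw]; exact h.vertex_one w hw
    · rw [hv w hw]; exact h.vertex_two w hw
    · rw [hp] at h2
      split_ifs at h2 with h3
      · exact Or.inl ⟨u, y, huv, h3.1, h3.2⟩
      · exact hs a b h2
  · have h1 := hA u x huv
    have hp : ∀ a b, push F x (u + n) a b =
        if a = u + n ∧ b = x then F a b - 1 else F a b := by
      intro a b; simp [push, hf]
    have hle : ∀ a b, push F x (u + n) a b ≠ 0 → F a b ≠ 0 := by
      intro a b h2
      rw [hp] at h2
      split_ifs at h2 <;> omega
    have hv : ∀ w < n, push F x (u + n) w (w + n) = F w (w + n) := by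
      intro w hw; rw [hp, if_neg (by omega)]
    refine ⟨⟨h.edge, fun a b hab h2 => h.edge_flow a b hab (hle _ _ h2), h.vertex,
      fun w hw => ?_, fun w hw => ?_, fun w hw => ?_⟩, fun a b h2 => hs a b (hle _ _ h2)⟩
    · rw [hv w hw]; exact h.vertex_zero w hw
    · rw [hv w hw]; exact h.vertex_one w hw
    · rw [hv w hw]; exact h.vertex_two w hw
  · have hp : ∀ a b, push F x (x + n) a b =
        if a = x ∧ b = x + n then F a b + 1 else F a b := by
      intro a b; simp [push, hvert x hx]
    refine ⟨⟨h.edge, fun a b hab h2 => ?_, h.vertex, fun w hw => ?_, fun w hw => ?_,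
      fun w hw => ?_⟩, fun a b h2 => ?_⟩
    · rw [hp, if_neg (by omega)] at h2
      exact h.edge_flow a b hab h2
    · have := h.vertex_zero w hw
      rw [hp]; grind
    · have := h.vertex_one w hw
      rw [hp]; grind
    · have := h.vertex_two w hw
      rw [hp]; grind
    · rw [hp] at h2
      split_ifs at h2 with h3
      · rw [h3.1, h3.2]; exact Or.inr ⟨hx, rfl⟩
      · exact hs a b h2
  · have hp : ∀ a b, push F (y + n) y a b =
        if a = y ∧ b = y + n then F a b - 1 else F a b := by
      intro a b; simp [push, hf]
    refine ⟨⟨h.edge, fun a b hab h2 => ?_, h.vertex, fun w hw => ?_, fun w hw => ?_,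
      fun w hw => ?_⟩, fun a b h2 => ?_⟩
    · rw [hp, if_neg (by omega)] at h2
      exact h.edge_flow a b hab h2
    · have := h.vertex_zero w hw
      have := h.vertex w hw
      have := h.vertex_two w hw
      have := h.vertex_one w hw
      rw [hp]; grind
    · have := h.vertex_one w hw
      rw [hp]; grind
    · have := h.vertex_two w hw
      rw [hp]; grind
    · rw [hp] at h2
      exact hs a b (by split_ifs at h2 <;> omega)

lemma Adm.ne {x y : ℕ} (h : Adm n A F π x y) : x ≠ y := by
  rcases h with ⟨u, v, h, rfl, rfl, -⟩ | ⟨u, v, h, rfl, rfl, -⟩ | ⟨h, rfl, -⟩ | ⟨h, rfl, -⟩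
  · have := hA _ _ h; omega
  · have := hA _ _ h; omega
  · omega
  · omega

/-- If `R` is closed under admissible arcs, then the potentials of all nodes outside of `R` can be
raised by `1`. -/
lemma IsPotential.raise (h : IsPotential n A F π) {R : ℕ → Prop} [DecidablePred R]
    (hR : ∀ a < 2 * n, ∀ b < 2 * n, R a → Adm n A F π a b → R b) {π' : ℕ → ℕ}
    (hπ' : ∀ a < 2 * n, π' a = π a + if R a then 0 else 1) :
    IsPotential n A F π' := by
  have hfw : ∀ u v, A u v → R (u + n) → π v = π (u + n) → R v := fun u v huv hu hπ =>
    hR _ (by have := hA u v huv; omega) _ (by have := hA u v huv; omega) hu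
      (Or.inl ⟨u, v, huv, rfl, rfl, hπ⟩)
  have hbw : ∀ u v, A u v → R v → F (u + n) v ≠ 0 → R (u + n) := fun u v huv hv hf =>
    hR _ (by have := hA u v huv; omega) _ (by have := hA u v huv; omega) hv
      (Or.inr (Or.inl ⟨u, v, huv, rfl, rfl, hf⟩))
  have hin : ∀ v < n, R v → ((F v (v + n) = 0 ∧ π (v + n) = π v) ∨
      (F v (v + n) ≠ 0 ∧ π (v + n) = π v + 1)) → R (v + n) := fun v hv hr hf =>
    hR _ (by omega) _ (by omega) hr (Or.inr (Or.inr (Or.inl ⟨hv, rfl, hf⟩)))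
  have hout : ∀ v < n, R (v + n) → F v (v + n) ≠ 0 → (F v (v + n) = 1 → π (v + n) = π v) →
      R v := fun v hv hr hf hf' =>
    hR _ (by omega) _ (by omega) hr (Or.inr (Or.inr (Or.inr ⟨hv, rfl, hf, hf'⟩)))
  constructor
  · intro u v huv
    have h1 := h.edge u v huv
    have h2 := hfw u v huv
    obtain ⟨h3, h4, -⟩ := hA u v huv
    rw [hπ' _ (by omega), hπ' _ (by omega)]
    grind
  · intro u v huv hf
    have h1 := h.edge u v huv
    have h2 := hbw u v huv
    have h5 := h.edge_flow u v huv hf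
    obtain ⟨h3, h4, -⟩ := hA u v huv
    rw [hπ' _ (by omega), hπ' _ (by omega)]
    grind
  all_goals
    intro v hv
    have h1 := h.vertex v hv
    have h2 := h.vertex_zero v hv
    have h3 := h.vertex_one v hv
    have h4 := h.vertex_two v hv
    have h5 := hin v hv
    have h6 := hout v hv
    rw [hπ' _ (by omega), hπ' _ (by omega)]
    grind

end

end SeparatorPathDuality

/-! ### Separator chains from layers -/

namespace SimpleGraph

open Relation

variable {V : Type*} {G : SimpleGraph V} {s t u v : V} {B B' : Set V}

lemma mem_reachAvoiding_iff : v ∈ G.reachAvoiding B u ↔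
    u ∉ B ∧ ReflTransGen (fun a b => G.Adj a b ∧ b ∉ B) u v := by
  constructor
  · rintro ⟨hu, hv, h⟩
    refine ⟨hu, ?_⟩
    rw [reachable_iff_reflTransGen] at h
    exact h.lift (Subtype.val) fun a b hab => ⟨hab, b.2⟩
  · rintro ⟨hu, h⟩
    induction h with
    | refl => exact ⟨hu, hu, Reachable.refl _⟩
    | tail _ h2 ih =>
      obtain ⟨_, hv, h3⟩ := ih
      have h4 : (G.induce Bᶜ).Adj ⟨_, hv⟩ ⟨_, h2.2⟩ := h2.1
      exact ⟨hu, h2.2, h3.trans h4.reachable⟩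

lemma reachAvoiding_symm (h : v ∈ G.reachAvoiding B u) : u ∈ G.reachAvoiding B v := by
  obtain ⟨hu, hv, h⟩ := h
  exact ⟨hv, hu, h.symm⟩

lemma reachAvoiding_trans {w : V} (h : v ∈ G.reachAvoiding B u) (h' : w ∈ G.reachAvoiding B v) :
    w ∈ G.reachAvoiding B u := by
  obtain ⟨hu, hv, h⟩ := h
  obtain ⟨_, hw, h'⟩ := h'
  exact ⟨hu, hw, h.trans h'⟩

lemma not_mem_of_mem_reachAvoiding (h : v ∈ G.reachAvoiding B u) : v ∉ B := by
  obtain ⟨_, hv, _⟩ := h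
  exact hv

lemma reachAvoiding_adj (h : v ∈ G.reachAvoiding B u) {w : V} (hvw : G.Adj v w) (hw : w ∉ B) :
    w ∈ G.reachAvoiding B u := by
  rw [mem_reachAvoiding_iff] at h ⊢
  exact ⟨h.1, h.2.tail ⟨hvw, hw⟩⟩

lemma reachAvoiding_subset (h : ∀ w ∈ G.reachAvoiding B u, w ∉ B') :
    G.reachAvoiding B u ⊆ G.reachAvoiding B' u := by
  intro v hv
  rw [mem_reachAvoiding_iff] at hv
  obtain ⟨hu, hv⟩ := hv
  induction hv with
  | refl =>
    exact mem_reachAvoiding_iff.2 ⟨h u (mem_reachAvoiding_iff.2 ⟨hu, .refl⟩), .refl⟩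
  | tail h1 h2 ih =>
    exact reachAvoiding_adj ih h2.1 (h _ (mem_reachAvoiding_iff.2 ⟨hu, h1.tail h2⟩))

lemma reachAvoiding_anti (h : B' ⊆ B) : G.reachAvoiding B u ⊆ G.reachAvoiding B' u :=
  reachAvoiding_subset fun _ hw hB => not_mem_of_mem_reachAvoiding hw (h hB)

lemma IsSTSeparator.symm (h : G.IsSTSeparator s t B) : G.IsSTSeparator t s B :=
  ⟨h.2.1, h.1, fun h' => h.2.2 (reachAvoiding_symm h')⟩

/-- The vertices that a search from `u` discovers if it does not continue at vertices of `B`. -/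
def searchSet (G : SimpleGraph V) (B : Set V) (u : V) : Set V :=
  {v | ReflTransGen (fun a b => G.Adj a b ∧ a ∉ B) u v}

lemma mem_searchSet (hu : u ∉ B) (h : v ∈ G.searchSet B u) :
    v ∈ G.reachAvoiding B u ∨ (v ∈ B ∧ ∃ a ∈ G.reachAvoiding B u, G.Adj a v) := by
  induction h with
  | refl => exact Or.inl (mem_reachAvoiding_iff.2 ⟨hu, .refl⟩)
  | @tail b c _ h2 ih =>
    rcases ih with h3 | ⟨h3, -⟩
    · by_cases hv : c ∈ B
      · exact Or.inr ⟨hv, _, h3, h2.1⟩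
      · exact Or.inl (reachAvoiding_adj h3 h2.1 hv)
    · exact absurd h3 h2.2

lemma reachAvoiding_subset_searchSet : G.reachAvoiding B u ⊆ G.searchSet B u := by
  intro v hv
  rw [mem_reachAvoiding_iff] at hv
  obtain ⟨hu, h⟩ := hv
  have : v ∈ G.searchSet B u ∧ v ∉ B := by
    induction h with
    | refl => exact ⟨.refl, hu⟩
    | tail _ h2 ih => exact ⟨ih.1.tail ⟨h2.1, ih.2⟩, h2.2⟩
  exact this.1

/-- The vertices of a separator that can be reached from the source before the separator is passed
form a separator. -/
lemma IsSTSeparator.inter_searchSet (h : G.IsSTSeparator s t B) :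
    G.IsSTSeparator s t (B ∩ G.searchSet B s) := by
  refine ⟨fun h' => h.1 h'.1, fun h' => h.2.1 h'.1, fun h' => h.2.2 ?_⟩
  rw [mem_reachAvoiding_iff] at h'
  obtain ⟨-, h'⟩ := h'
  obtain ⟨hs, -, -⟩ := h
  induction h' with
  | refl => exact mem_reachAvoiding_iff.2 ⟨hs, .refl⟩
  | tail _ h2 ih =>
    refine reachAvoiding_adj ih h2.1 fun hB => h2.2 ⟨hB, ?_⟩
    exact (reachAvoiding_subset_searchSet ih).tail ⟨h2.1, not_mem_of_mem_reachAvoiding ih⟩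

/-- The vertices of the separator `B` that are discovered from `s`, and then from `t`. -/
def trim (G : SimpleGraph V) (s t : V) (B : Set V) : Set V :=
  (B ∩ G.searchSet B s) ∩ G.searchSet (B ∩ G.searchSet B s) t

lemma trim_subset : G.trim s t B ⊆ B := fun _ h => h.1.1

lemma IsSTSeparator.exists_adj_of_mem_trim (h : G.IsSTSeparator s t B) (hv : v ∈ G.trim s t B) :
    (∃ a ∈ G.reachAvoiding B s, G.Adj a v) ∧
      ∃ a ∈ G.reachAvoiding (B ∩ G.searchSet B s) t, G.Adj a v := by
  constructor
  · rcases mem_searchSet h.1 hv.1.2 with h1 | h1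
    · exact absurd hv.1.1 (not_mem_of_mem_reachAvoiding h1)
    · exact h1.2
  · rcases mem_searchSet h.inter_searchSet.2.1 hv.2 with h1 | h1
    · exact absurd hv.1 (not_mem_of_mem_reachAvoiding h1)
    · exact h1.2

lemma IsSTSeparator.minimal_trim (h : G.IsSTSeparator s t B) :
    Minimal (G.IsSTSeparator s t) (G.trim s t B) := by
  refine ⟨h.inter_searchSet.symm.inter_searchSet.symm, fun C hC hCle v hv => ?_⟩
  by_contra hvC
  obtain ⟨⟨a, ha, hav⟩, b, hb, hbv⟩ := h.exists_adj_of_mem_trim hv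
  have h1 := reachAvoiding_adj (reachAvoiding_anti (hCle.trans trim_subset) ha) hav hvC
  have h2 := reachAvoiding_adj (reachAvoiding_anti (hCle.trans fun _ h => h.1) hb) hbv hvC
  exact hC.2.2 (reachAvoiding_trans h1 (reachAvoiding_symm h2))

/-- Disjoint separators, none of which is discovered from `s` before an earlier one is passed,
contain the members of a separator chain. -/
theorem isSeparatorChain_trim {p : ℕ} {L : Fin p → Set V}
    (hsep : ∀ i, G.IsSTSeparator s t (L i)) (hdisj : ∀ i j, i ≠ j → Disjoint (L i) (L j))
    (hord : ∀ i j, i < j → Disjoint (G.searchSet (L i) s) (L j)) :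
    G.IsSeparatorChain s t (fun i => G.trim s t (L i)) := by
  refine ⟨fun i => (hsep i).minimal_trim,
    fun i j hij => (hdisj i j hij).mono trim_subset trim_subset, fun i j hij => ?_⟩
  -- the `i`-th member is reachable from `s` even without passing the whole of `L j`
  have h1 : G.trim s t (L i) ⊆ G.reachAvoiding (L j) s := by
    intro v hv
    obtain ⟨⟨a, ha, hav⟩, -⟩ := (hsep i).exists_adj_of_mem_trim hv
    refine reachAvoiding_adj (reachAvoiding_subset (fun w hw => ?_) ha) hav ?_
    · exact Set.disjoint_left.1 (hord i j hij) (reachAvoiding_subset_searchSet hw)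
    · exact Set.disjoint_left.1 (hdisj i j hij.ne) (trim_subset hv)
  refine ⟨h1.trans (reachAvoiding_anti trim_subset), fun v hv => ?_⟩
  obtain ⟨-, b, hb, hbv⟩ := (hsep j).exists_adj_of_mem_trim hv
  refine reachAvoiding_adj (reachAvoiding_subset (fun w hw hwi => ?_) hb) hbv ?_
  -- a vertex of the `i`-th member on the side of `t` would connect `s` and `t`
  · exact (hsep j).inter_searchSet.2.2 (reachAvoiding_trans
      (reachAvoiding_anti Set.inter_subset_left (h1 hwi)) (reachAvoiding_symm hw))
  · exact fun h => Set.disjoint_left.1 (hdisj i j hij.ne) (trim_subset h) (trim_subset hv)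

end SimpleGraph

/-! ### The two outcomes -/

namespace SeparatorPathDuality

open SimpleGraph

/-- The adjacency relation of a graph on `Fin n`, as a relation on natural numbers. -/
def natAdj {n : ℕ} (G : SimpleGraph (Fin n)) (u v : ℕ) : Prop :=
  ∃ (hu : u < n) (hv : v < n), G.Adj ⟨u, hu⟩ ⟨v, hv⟩

section

variable {n : ℕ} {G : SimpleGraph (Fin n)}

lemma natAdj_lt {u v : ℕ} (h : natAdj G u v) : u < n ∧ v < n ∧ u ≠ v := by
  obtain ⟨hu, hv, h⟩ := h
  exact ⟨hu, hv, fun h' => h.ne (Fin.ext h')⟩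

lemma natAdj_fin {u v : Fin n} : natAdj G u v ↔ G.Adj u v :=
  ⟨fun ⟨_, _, h⟩ => h, fun h => ⟨u.2, v.2, h⟩⟩

/-- The vertices at which the potential rises from `i` to `i + 1`. -/
def layer (n : ℕ) (π : ℕ → ℕ) (i : ℕ) : Set (Fin n) := {v | π v = i ∧ π (v + n) = i + 1}

variable {F : ℕ → ℕ → ℕ} {π : ℕ → ℕ} {s t : Fin n} {D i : ℕ}

lemma IsPotential.le_of_mem_reachAvoiding (h : IsPotential n (natAdj G) F π) (hs : π (s + n) = 0)
    {v : Fin n} (hv : v ∈ G.reachAvoiding (layer n π i) s) :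
    π (v + n) ≤ i ∧ (v = s ∨ π v ≤ i) := by
  rw [mem_reachAvoiding_iff] at hv
  obtain ⟨-, hv⟩ := hv
  induction hv with
  | refl => exact ⟨by omega, Or.inl rfl⟩
  | @tail a b _ h2 ih =>
    have h3 := h.edge a b (natAdj_fin.2 h2.1)
    have h4 := h.vertex b b.2
    have h5 : ¬ (π b = i ∧ π (b + n) = i + 1) := h2.2
    omega

lemma IsPotential.isSTSeparator_layer (h : IsPotential n (natAdj G) F π) (hst : s ≠ t)
    (hs : π (s + n) = 0) (ht : π t = D) (hi : i < D) : G.IsSTSeparator s t (layer n π i) := by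
  refine ⟨fun h1 => ?_, fun h1 => ?_, fun h1 => ?_⟩
  · have := h1.2; omega
  · have := h1.1; omega
  · rcases (h.le_of_mem_reachAvoiding hs h1).2 with h2 | h2
    · exact hst h2.symm
    · omega

theorem IsPotential.isSeparatorChain (h : IsPotential n (natAdj G) F π) (hst : s ≠ t)
    (hs : π (s + n) = 0) (ht : π t = D) {p : ℕ} (hp : p ≤ D) :
    G.IsSeparatorChain s t (fun j : Fin p => G.trim s t (layer n π j)) := by
  have hsep : ∀ i : Fin p, G.IsSTSeparator s t (layer n π i) := fun i =>
    h.isSTSeparator_layer hst hs ht (by omega)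
  refine isSeparatorChain_trim hsep (fun i j hij => ?_) (fun i j hij => ?_)
  · refine Set.disjoint_left.2 fun v h1 h2 => hij (Fin.ext ?_)
    rw [← h1.1, ← h2.1]
  · refine Set.disjoint_left.2 fun v h1 h2 => ?_
    have h3 : π (v + n) = j + 1 := h2.2
    have h4 : (i : ℕ) < j := hij
    rcases mem_searchSet (hsep i).1 h1 with h5 | ⟨h5, -⟩
    · have := (h.le_of_mem_reachAvoiding hs h5).1; omega
    · have : π (v + n) = i + 1 := h5.2; omega

/-- All layers are nonempty, so the potential of `t` is smaller than `n`. -/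
lemma IsPotential.lt_card (h : IsPotential n (natAdj G) F π) (hG : G.Connected) (hst : s ≠ t)
    (hs : π (s + n) = 0) (ht : π t = D) : D < n := by
  have hsub : Finset.range (D + 1) ⊆ (Finset.univ : Finset (Fin n)).image
      fun v : Fin n => π (v + n) := by
    intro i hi
    rw [Finset.mem_image]
    rw [Finset.mem_range] at hi
    rcases Nat.eq_zero_or_pos i with rfl | hi0
    · exact ⟨s, Finset.mem_univ _, hs⟩
    · have h1 := h.isSTSeparator_layer (i := i - 1) hst hs ht (by omega)
      have h2 : (layer n π (i - 1)).Nonempty := by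
        by_contra h3
        rw [Set.not_nonempty_iff_eq_empty] at h3
        rw [h3] at h1
        refine h1.2.2 (mem_reachAvoiding_iff.2 ⟨id, ?_⟩)
        have h4 := hG.preconnected s t
        rw [reachable_iff_reflTransGen] at h4
        exact h4.lift id fun a b hab => ⟨hab, id⟩
      obtain ⟨v, hv⟩ := h2
      have : π (v + n) = i - 1 + 1 := hv.2
      exact ⟨v, Finset.mem_univ _, by omega⟩
  have := (Finset.card_le_card hsub).trans Finset.card_image_le
  simpa using this

/-- Only the vertices of a layer carry flow across the corresponding cut of the split graph, and
each of them carries some. -/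
lemma IsPotential.card_layer_le (h : IsPotential n (natAdj G) F π) {val : ℕ}
    (hF : IsFlow n (natAdj G) s t val F) (hs : π (s + n) = 0) (ht : π t = D) (hi : i < D)
    {C : Finset (Fin n)} (hC : (C : Set (Fin n)) ⊆ layer n π i) : C.card ≤ val := by
  set X := (Finset.range (2 * n)).filter fun a => i + 1 ≤ π a with hX
  have hsX : (s : ℕ) + n ∉ X := by simp [hX, hs]
  have htX : (t : ℕ) ∈ X := by
    simp only [hX, Finset.mem_filter, Finset.mem_range]; omega
  have hcut := hF.cut X (Finset.filter_subset _ _) htX hsX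
  have hout : ∀ a ∈ X, ∀ b ∈ Finset.range (2 * n) \ X, F a b = 0 := by
    intro a ha b hb
    simp only [hX, Finset.mem_filter, Finset.mem_range, Finset.mem_sdiff] at ha hb
    by_contra h0
    rcases hF.arc a b h0 with ⟨u, v, huv, rfl, rfl⟩ | ⟨hv, rfl⟩
    · have := h.edge_flow u b huv h0; omega
    · have := h.vertex_one a hv (by omega); omega
  have hle : ∑ v ∈ C, (1 : ℤ) ≤
      ∑ a ∈ X, ∑ b ∈ Finset.range (2 * n) \ X, ((F b a : ℤ) - F a b) := by
    have hinj : Set.InjOn (fun v : Fin n => (v : ℕ) + n) C := by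
      intro a _ b _ hab
      exact Fin.ext (by simpa using hab)
    have hpos : ∀ a ∈ X, ∀ b ∈ Finset.range (2 * n) \ X, (0 : ℤ) ≤ (F b a : ℤ) - F a b := by
      intro a ha b hb
      rw [hout a ha b hb]; simp
    have hsub : C.image (fun v : Fin n => (v : ℕ) + n) ⊆ X := by
      intro a ha
      obtain ⟨v, hv, rfl⟩ := Finset.mem_image.1 ha
      have h1 : π (v + n) = i + 1 := (hC hv).2
      simp only [hX, Finset.mem_filter, Finset.mem_range]; omega
    refine le_trans ?_ (Finset.sum_le_sum_of_subset_of_nonneg hsub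
      fun a ha _ => Finset.sum_nonneg (hpos a ha))
    rw [Finset.sum_image hinj]
    refine Finset.sum_le_sum fun v hv => ?_
    obtain ⟨h1, h2⟩ : π v = i ∧ π (v + n) = i + 1 := hC hv
    have hvX : (v : ℕ) + n ∈ X := hsub (Finset.mem_image_of_mem _ hv)
    have hvX' : (v : ℕ) ∈ Finset.range (2 * n) \ X := by
      simp only [hX, Finset.mem_filter, Finset.mem_range, Finset.mem_sdiff]; omega
    refine le_trans ?_ (Finset.single_le_sum (hpos _ hvX) hvX')
    have h3 := h.vertex_zero v v.2
    have h4 := hout _ hvX _ hvX'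
    rw [h4]
    omega
  rw [← hcut] at hle
  simpa using hle

end

end SeparatorPathDuality

/-! ### Computing the flow -/

namespace SeparatorPathDuality

open RAM

/-- The test whether the nodes in registers `20` and `21` form an admissible arc; the summands
correspond to the cases of `Adm`. The truncated differences `a - n` and `b - n` count only if the
node is an out-node. -/
def admE : Expr :=
  let a : Expr := .reg 20
  let b : Expr := .reg 21
  let n : Expr := .reg 0
  let f : Expr := .cell 4 (posE a b)
  let g : Expr := .cell 4 (posE b a)
  let x : Expr := .cell 5 a
  let y : Expr := .cell 5 b
  .add (.bAnd (.bAnd (.bLe n a) (.sub n b))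
    (.bAnd (.cell 0 (.add (.cell 3 (.sub a n)) b)) (.bEq y x)))
  (.add (.bAnd (.bAnd (.sub n a) (.bLe n b)) (.bAnd (.cell 0 (.add (.cell 3 (.sub b n)) a)) g))
  (.add (.bAnd (.bAnd (.sub n a) (.bEq b (.add a n)))
    (.add (.bAnd (.bNot f) (.bEq y x)) (.bAnd f (.bEq y (.add x (.const 1))))))
  (.bAnd (.bAnd (.sub n b) (.bEq a (.add b n)))
    (.bAnd g (.add (.bNot (.bEq g (.const 1))) (.bEq x y))))))

/-- Augments the flow along the path that the last search has found. -/
def augment : Cmd :=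
  .seq (.assign 14 (.reg 2)) (.seq follow (.assign 8 (.add (.reg 8) (.const 1))))

/-- Raises the potentials of the nodes that the last search has not reached. -/
def raise : Cmd :=
  .seq (.loop 24 5 (.store 5 (.reg 24)
    (.add (.cell 5 (.reg 24)) (.sub (.const 1) (.cell 7 (.reg 24))))))
  (.assign 9 (.add (.reg 9) (.const 1)))

/-- Augments the flow if possible, and raises the potentials otherwise, unless the value of the flow
is `q` or the potential of `t` is `p'`. -/
def augmentStep : Cmd :=
  .ite (.bAnd (.sub (.reg 4) (.reg 8)) (.sub (.reg 6) (.reg 9)))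
    (.seq (search admE (.add (.reg 1) (.reg 0))) (.ite (.cell 7 (.reg 2)) augment raise))
    .skip

/-- Array `4` represents the flow `F` of value `val`, where `val` is in register `8`, and array `5`
contains optimal potentials for it, with the potential of `t` in register `9`. -/
structure Optimal (n s t : ℕ) (A : ℕ → ℕ → Prop) (F : ℕ → ℕ → ℕ) (σ : State) : Prop where
  rep : ∀ a < 2 * n, ∀ b < 2 * n, σ.mem 4 (pos n a b) = F a b
  flow : IsFlow n A s t (σ.reg 8) F
  pot : IsPotential n A F (σ.mem 5)
  source : σ.mem 5 (s + n) = 0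
  sink : σ.mem 5 t = σ.reg 9

section

variable {n s t q p' : ℕ} {A : ℕ → ℕ → Prop} {σ : State} {F : ℕ → ℕ → ℕ}

lemma Optimal.congr {τ : State} (h : Optimal n s t A F σ) (h4 : τ.mem 4 = σ.mem 4)
    (h5 : τ.mem 5 = σ.mem 5) (h8 : τ.reg 8 = σ.reg 8) (h9 : τ.reg 9 = σ.reg 9) :
    Optimal n s t A F τ where
  rep := by rw [h4]; exact h.rep
  flow := by rw [h8]; exact h.flow
  pot := by rw [h5]; exact h.pot
  source := by rw [h5]; exact h.source
  sink := by rw [h5, h9]; exact h.sink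

variable (hA : ∀ u v, A u v → u < n ∧ v < n ∧ u ≠ v)

include hA

lemma holds_admE (h : Setup n s t q p' A σ)
    (hF : ∀ a < 2 * n, ∀ b < 2 * n, σ.mem 4 (pos n a b) = F a b) {π : ℕ → ℕ}
    (hπ : σ.mem 5 = π) {a b : ℕ} (ha : a < 2 * n) (hb : b < 2 * n) (h20 : σ.reg 20 = a)
    (h21 : σ.reg 21 = b) : admE.holds σ ↔ Adm n A F π a b := by
  have h1 : (posE (.reg 20) (.reg 21)).eval σ = pos n a b := by
    rw [h.eval_posE (by simpa [Expr.eval, h20] using ha)]; simp [Expr.eval, h20, h21]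
  have h2 : (posE (.reg 21) (.reg 20)).eval σ = pos n b a := by
    rw [h.eval_posE (by simpa [Expr.eval, h21] using hb)]; simp [Expr.eval, h20, h21]
  simp only [admE, Expr.holds_add, Expr.holds_bAnd, Expr.holds_bLe, Expr.holds_sub,
    Expr.holds_cell, Expr.holds_bEq, Expr.holds_bNot, Expr.eval, h1, h2, h20, h21, h.r0, hπ,
    hF a ha b hb, hF b hb a ha, Adm]
  refine or_congr ?_ (or_congr ?_ (or_congr ?_ ?_))
  · constructor
    · rintro ⟨⟨h3, h4⟩, h5, h6⟩
      rw [h.row _ (by omega), h.adj _ (by omega) _ h4] at h5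
      exact ⟨a - n, b, h5, by omega, rfl, by rw [h6, Nat.sub_add_cancel h3]⟩
    · rintro ⟨u, v, h3, rfl, rfl, h5⟩
      have h6 := hA u b h3
      rw [Nat.add_sub_cancel, h.row _ (by omega), h.adj _ h6.1 _ h6.2.1]
      exact ⟨⟨by omega, h6.2.1⟩, h3, h5⟩
  · constructor
    · rintro ⟨⟨h3, h4⟩, h5, h6⟩
      rw [h.row _ (by omega), h.adj _ (by omega) _ h3] at h5
      exact ⟨b - n, a, h5, rfl, by omega, by rwa [Nat.sub_add_cancel h4]⟩
    · rintro ⟨u, v, h3, rfl, rfl, h5⟩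
      have h6 := hA u a h3
      rw [Nat.add_sub_cancel, h.row _ (by omega), h.adj _ h6.1 _ h6.2.1]
      exact ⟨⟨h6.2.1, by omega⟩, h3, h5⟩
  · grind
  · grind

/-- Pushing along the path that a search in the admissible arcs has found preserves optimality:
the arcs of the path that are still to come are not yet affected. -/
lemma sem_follow_adm (h : Setup n s t q p' A σ) (hO : Optimal n s t A F σ)
    (ht : t < n)
    (T : SearchTree (Adm n A F (σ.mem 5)) (2 * n) (s + n) (σ.mem 7) (σ.mem 8))
    (h13 : σ.reg 13 = s + n) (h14 : σ.reg 14 = t) (hreach : σ.mem 7 t ≠ 0) :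
    ∃ F', (∀ a < 2 * n, ∀ b < 2 * n, (follow.sem σ).mem 4 (pos n a b) = F' a b) ∧
      IsFlow n A s t (σ.reg 8 + 1) F' ∧ IsPotential n A F' (σ.mem 5) := by
  obtain ⟨F', ⟨h1, h2, h3, -⟩, h4⟩ := sem_follow h rfl T h13 h14 (by omega) hreach rfl hO.rep
    (fun y F' _ _ => IsPotential n A F' (σ.mem 5) ∧ (∀ a b, F' a b ≠ 0 → Arc n A a b) ∧
      (∀ a, net n F' a = net n F a + (if a = t then 1 else 0) - (if a = y then 1 else 0)) ∧
      ∀ a b, σ.mem 7 a < σ.mem 7 y ∨ σ.mem 7 b < σ.mem 7 y → F' a b = F a b)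
    ⟨hO.pot, hO.flow.arc, by simp, fun _ _ _ => rfl⟩ (by
      rintro y F' len out hy hym hyr hx hmx hadm ⟨i1, i2, i3, i4⟩
      set x := σ.mem 8 y with hxdef
      have hadm' : Adm n A F' (σ.mem 5) x y := by
        have e1 := i4 x y (by omega)
        have e2 := i4 y x (by omega)
        unfold Adm at hadm ⊢
        rcases hadm with h | ⟨u, v, h, h', h'', h3⟩ | h | h
        · exact Or.inl h
        · refine Or.inr (Or.inl ⟨u, v, h, h', h'', ?_⟩)
          rwa [← h', ← h'', e2, h', h'']
        · rw [← e1] at h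
          exact Or.inr (Or.inr (Or.inl h))
        · rw [← e2] at h
          exact Or.inr (Or.inr (Or.inr h))
      obtain ⟨j1, j2⟩ := i1.push_adm hA i2 hadm'
      refine ⟨j1, j2, fun a => ?_, fun a b hab => ?_⟩
      · rw [net_push hx hy (hadm'.ne hA), i3]; ring
      · rw [push_apply_of_ne, i4 a b (by omega)]
        · rintro ⟨rfl, rfl⟩; omega
        · rintro ⟨rfl, rfl⟩; omega)
  refine ⟨F', h4, ⟨h2, fun a ha => ?_⟩, h1⟩
  rw [h3, hO.flow.net_eq a ha]; ring

lemma Optimal.augment (h : Setup n s t q p' A σ) (hO : Optimal n s t A F σ) (ht : t < n)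
    (T : SearchTree (Adm n A F (σ.mem 5)) (2 * n) (s + n) (σ.mem 7) (σ.mem 8))
    (h13 : σ.reg 13 = s + n) (hreach : σ.mem 7 t ≠ 0) :
    ∃ F', Optimal n s t A F' (augment.sem σ) ∧
      (augment.sem σ).reg 8 = σ.reg 8 + 1 ∧ (augment.sem σ).reg 9 = σ.reg 9 := by
  rw [SeparatorPathDuality.augment, Cmd.sem_seq, Cmd.sem_seq]
  obtain ⟨σ₁, hσ₁⟩ : ∃ τ, τ = (Cmd.assign 14 (.reg 2)).sem σ := ⟨_, rfl⟩
  have hS₁ : Setup n s t q p' A σ₁ := by rw [hσ₁]; exact h.setReg (by decide)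
  have hmem : σ₁.mem = σ.mem := by rw [hσ₁]; rfl
  have h8 : σ₁.reg 8 = σ.reg 8 := by rw [hσ₁, Cmd.sem_reg (by decide)]
  have h9 : σ₁.reg 9 = σ.reg 9 := by rw [hσ₁, Cmd.sem_reg (by decide)]
  obtain ⟨F', k1, k2, k3⟩ := sem_follow_adm hA hS₁
    (hO.congr (by rw [hmem]) (by rw [hmem]) h8 h9) ht
    (by rw [hmem]; exact T) (by rw [hσ₁, Cmd.sem_reg (by decide), h13])
    (by simp [hσ₁, Cmd.sem, Expr.eval, h.r2]) (by rw [hmem]; exact hreach)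
  rw [← hσ₁]
  have f8 : (follow.sem σ₁).reg 8 = σ.reg 8 := by rw [Cmd.sem_reg (by decide), h8]
  have f9 : (follow.sem σ₁).reg 9 = σ.reg 9 := by rw [Cmd.sem_reg (by decide), h9]
  have f5 : (follow.sem σ₁).mem 5 = σ.mem 5 := by rw [Cmd.sem_mem (by decide), hmem]
  rw [h8] at k2
  rw [hmem] at k3
  rw [← f8, ← f9]
  generalize follow.sem σ₁ = ρ at k1 f8 f9 f5
  refine ⟨F', ⟨k1, ?_, ?_, ?_, ?_⟩, by simp [Cmd.sem, Expr.eval], by simp [Cmd.sem]⟩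
  · simpa [Cmd.sem, Expr.eval, f8] using k2
  · simpa [Cmd.sem, f5] using k3
  · simpa [Cmd.sem, f5] using hO.source
  · simpa [Cmd.sem, f5, f9] using hO.sink

lemma Optimal.raise (h : Setup n s t q p' A σ) (hO : Optimal n s t A F σ) (ht : t < n)
    (T : SearchTree (Adm n A F (σ.mem 5)) (2 * n) (s + n) (σ.mem 7) (σ.mem 8))
    (hreach : σ.mem 7 t = 0) :
    Optimal n s t A F (raise.sem σ) ∧
      (raise.sem σ).reg 8 = σ.reg 8 ∧ (raise.sem σ).reg 9 = σ.reg 9 + 1 := by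
  obtain ⟨ρ, hρ, hfρ, hsρ⟩ := Cmd.loop_rule (x := 24) (b := 5) (c := .store 5 (.reg 24)
      (.add (.cell 5 (.reg 24)) (.sub (.const 1) (.cell 7 (.reg 24))))) (σ := σ)
    (fun i τ => ∀ a, τ.mem 5 a = σ.mem 5 a + if a < i ∧ σ.mem 7 a = 0 then 1 else 0) h.r5
    (by simp) (by
      intro i hi τ hf hI a
      have h7 : τ.mem 7 = σ.mem 7 := hf.2 7 (by decide)
      simp only [Cmd.sem, State.setCell_mem, if_true, State.setReg_mem, Function.update_apply,
        Expr.eval, State.setReg_reg, hI, h7]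
      grind)
  rw [SeparatorPathDuality.raise, Cmd.sem, hsρ, Cmd.sem]
  have f8 : ρ.reg 8 = σ.reg 8 := hfρ.1 8 (by decide)
  have f9 : ρ.reg 9 = σ.reg 9 := hfρ.1 9 (by decide)
  have f4 : ρ.mem 4 = σ.mem 4 := hfρ.2 4 (by decide)
  refine ⟨⟨?_, ?_, ?_, ?_, ?_⟩, by simp [f8], by simp [Expr.eval, f9]⟩
  · simpa [f4] using hO.rep
  · simpa [f8] using hO.flow
  · refine hO.pot.raise hA (R := fun a => σ.mem 7 a ≠ 0)
      (fun a ha b hb h1 h2 => T.closed a ha b hb h1 h2) fun a ha => ?_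
    simp only [State.setReg_mem, hρ]
    grind
  · simp [hρ, hO.source, T.mark_root]
  · have : t < 2 * n := by omega
    simp [hρ, hO.sink, hreach, this, Expr.eval, f9]

lemma Optimal.augmentStep (h : Setup n s t q p' A σ) (hO : Optimal n s t A F σ)
    (hs : s < n) (ht : t < n) (hq : σ.reg 8 < q) (hp : σ.reg 9 < p') :
    ∃ F', Optimal n s t A F' (augmentStep.sem σ) ∧
      (((augmentStep.sem σ).reg 8 = σ.reg 8 + 1 ∧ (augmentStep.sem σ).reg 9 = σ.reg 9) ∨
      ((augmentStep.sem σ).reg 8 = σ.reg 8 ∧ (augmentStep.sem σ).reg 9 = σ.reg 9 + 1)) := by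
  obtain ⟨T, h13⟩ := sem_search h (e := admE) (r := .add (.reg 1) (.reg 0)) (root := s + n)
    (R := Adm n A F (σ.mem 5))
    (fun τ hτ hm a ha b hb h20 h21 => holds_admE hA hτ
      (by rw [hm 4 (by decide)]; exact hO.rep) (hm 5 (by decide)) ha hb h20 h21)
    (fun τ hτ => by simp [Expr.eval, hτ.r0, hτ.r1]) (by omega)
  rw [SeparatorPathDuality.augmentStep, Cmd.sem,
    if_pos (by simp [Expr.eval, h.r4, h.r6, hq, hp]), Cmd.sem]
  have hS := h.search admE (.add (.reg 1) (.reg 0))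
  have f8 : ((search admE (.add (.reg 1) (.reg 0))).sem σ).reg 8 = σ.reg 8 :=
    Cmd.sem_reg (not_mem_wregs_search (by decide))
  have f9 : ((search admE (.add (.reg 1) (.reg 0))).sem σ).reg 9 = σ.reg 9 :=
    Cmd.sem_reg (not_mem_wregs_search (by decide))
  have f4 : ((search admE (.add (.reg 1) (.reg 0))).sem σ).mem 4 = σ.mem 4 :=
    Cmd.sem_mem (not_mem_wmems_search (by decide))
  have f5 : ((search admE (.add (.reg 1) (.reg 0))).sem σ).mem 5 = σ.mem 5 :=
    Cmd.sem_mem (not_mem_wmems_search (by decide))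
  generalize (search admE (.add (.reg 1) (.reg 0))).sem σ = ρ at *
  have hOρ := hO.congr f4 f5 f8 f9
  rw [← f5] at T
  rw [← f8, ← f9, Cmd.sem]
  have hcond : (Expr.cell 7 (.reg 2)).holds ρ ↔ ρ.mem 7 t ≠ 0 := by simp [Expr.eval, hS.r2]
  by_cases hc : ρ.mem 7 t ≠ 0
  · rw [if_pos (hcond.2 hc)]
    obtain ⟨F', h1, h2⟩ := hOρ.augment hA hS ht T h13 hc
    exact ⟨F', h1, Or.inl h2⟩
  · rw [if_neg (fun h' => hc (hcond.1 h'))]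
    obtain ⟨h1, h2⟩ := hOρ.raise hA hS ht T (not_not.1 hc)
    exact ⟨F, h1, Or.inr h2⟩

/-- After sufficiently many steps, the value of the flow is `q` or the potential of `t` is `p'`. -/
lemma sem_loop_augmentStep (h : Setup n s t q p' A σ) (hO : Optimal n s t A F σ)
    (hs : s < n) (ht : t < n) (hp : p' ≤ n) (h8 : σ.reg 8 = 0)
    (h9 : σ.reg 9 = 0) :
    ∃ F', Optimal n s t A F' ((Cmd.loop 12 7 augmentStep).sem σ) ∧
      ((Cmd.loop 12 7 augmentStep).sem σ).reg 8 ≤ q ∧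
      ((Cmd.loop 12 7 augmentStep).sem σ).reg 9 ≤ p' ∧
      (((Cmd.loop 12 7 augmentStep).sem σ).reg 8 < q →
        p' ≤ ((Cmd.loop 12 7 augmentStep).sem σ).reg 9) := by
  obtain ⟨ρ, ⟨F', hO', h1, h2, h3⟩, -, hsρ⟩ := Cmd.loop_rule (x := 12) (b := 7) (c := augmentStep)
    (σ := σ) (fun i τ => ∃ F', Optimal n s t A F' τ ∧ τ.reg 8 ≤ q ∧ τ.reg 9 ≤ p' ∧
      (τ.reg 8 < q → τ.reg 9 < p' → i ≤ τ.reg 8 + τ.reg 9)) h.r7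
    ⟨F, hO, by omega, by omega, by omega⟩ (by
      rintro i hi τ hf ⟨F', hO', h1, h2, h3⟩
      have hS := (h.frame (by decide) hf).setReg (x := 12) (v := i) (by decide)
      have hO'' : Optimal n s t A F' (τ.setReg 12 i) := hO'.congr rfl rfl (by simp) (by simp)
      have e8 : (τ.setReg 12 i).reg 8 = τ.reg 8 := by simp
      have e9 : (τ.setReg 12 i).reg 9 = τ.reg 9 := by simp
      by_cases hc : τ.reg 8 < q ∧ τ.reg 9 < p'
      · obtain ⟨F₂, k1, k2⟩ := hO''.augmentStep hA hS hs ht (by omega) (by omega)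
        exact ⟨F₂, k1, by omega, by omega, by omega⟩
      · have hskip : augmentStep.sem (τ.setReg 12 i) = τ.setReg 12 i := by
          rw [SeparatorPathDuality.augmentStep, Cmd.sem, if_neg (by
            rw [Expr.holds_bAnd, Expr.holds_sub, Expr.holds_sub]
            simp only [Expr.eval, hS.r4, hS.r6, e8, e9]
            exact hc)]
          rfl
        rw [hskip]
        exact ⟨F', hO'', by omega, by omega, by omega⟩)
  rw [hsρ]
  have e8 : (ρ.setReg 12 (2 * n + q)).reg 8 = ρ.reg 8 := by simp
  have e9 : (ρ.setReg 12 (2 * n + q)).reg 9 = ρ.reg 9 := by simp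
  rw [e8, e9]
  exact ⟨F', hO'.congr rfl rfl e8 e9, h1, h2, fun h4 => by omega⟩

end

end SeparatorPathDuality

/-! ### Output of the separator chain -/

namespace SeparatorPathDuality

open RAM SimpleGraph

/-- The test whether the vertex in register `20` is not in the set in array `9`, and adjacent to the
vertex in register `21`. -/
def blockE : Expr :=
  .bAnd (.bAnd (.sub (.reg 0) (.reg 20)) (.sub (.reg 0) (.reg 21)))
    (.bAnd (.cell 0 (.add (.cell 3 (.reg 20)) (.reg 21))) (.bNot (.cell 9 (.reg 20))))

/-- Keeps those elements of the set in array `9` that a search from `r` discovers if it does not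
continue at elements of this set. -/
def block (r : Expr) : Cmd :=
  .seq (search blockE r)
    (.loop 24 0 (.store 9 (.reg 24) (.bAnd (.cell 9 (.reg 24)) (.cell 7 (.reg 24)))))

/-- Writes the separator that belongs to the layer with the number in register `12`. -/
def chainStep : Cmd :=
  .seq (.loop 24 0 (.store 9 (.reg 24) (.bAnd (.bEq (.cell 5 (.reg 24)) (.reg 12))
    (.bEq (.cell 5 (.add (.reg 24) (.reg 0))) (.add (.reg 12) (.const 1))))))
  (.seq (block (.reg 1)) (.seq (block (.reg 2))
    (.loop 24 0 (.store 1 (.add (.cell 3 (.reg 12)) (.reg 24)) (.cell 9 (.reg 24))))))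

section

variable {n q p' : ℕ} {G : SimpleGraph (Fin n)} {s t : Fin n} {σ : State}

open Classical in
lemma sem_block (h : Setup n s t q p' (natAdj G) σ) {r : Expr} {u : Fin n}
    (hr : ∀ τ : State, Setup n s t q p' (natAdj G) τ → r.eval τ = u) {B : Set (Fin n)}
    (hB : ∀ v : Fin n, σ.mem 9 v = if v ∈ B then 1 else 0) (v : Fin n) :
    ((block r).sem σ).mem 9 v = if v ∈ B ∩ G.searchSet B u then 1 else 0 := by
  set R : ℕ → ℕ → Prop := fun a b =>
    ∃ (ha : a < n) (hb : b < n), G.Adj ⟨a, ha⟩ ⟨b, hb⟩ ∧ ⟨a, ha⟩ ∉ B with hR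
  obtain ⟨T, -⟩ := sem_search h (e := blockE) (r := r) (root := u) (R := R)
    (fun τ hτ hm a ha b hb h20 h21 => by
      simp only [blockE, Expr.holds_bAnd, Expr.holds_sub, Expr.holds_cell, Expr.holds_bNot,
        Expr.eval, hτ.r0, h20, h21, hm 9 (by decide), hτ.row a (by omega), hR]
      constructor
      · rintro ⟨⟨ha', hb'⟩, h1, h2⟩
        rw [hτ.adj a ha' b hb'] at h1
        have := hB ⟨a, ha'⟩
        simp only at this
        refine ⟨ha', hb', natAdj_fin.1 h1, fun h3 => ?_⟩
        rw [this, if_pos h3] at h2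
        omega
      · rintro ⟨ha', hb', h1, h2⟩
        have := hB ⟨a, ha'⟩
        simp only at this
        rw [hτ.adj a ha' b hb', this, if_neg h2]
        exact ⟨⟨ha', hb'⟩, ⟨ha', hb', h1⟩, by omega⟩) hr (by omega)
  have hmark : ((search blockE r).sem σ).mem 7 v ≠ 0 ↔ v ∈ G.searchSet B u := by
    rw [T.mark_ne_zero_iff (by omega)]
    constructor
    · have key : ∀ x, Relation.ReflTransGen (fun a b => b < 2 * n ∧ R a b) u x →
          ∃ hx : x < n, (⟨x, hx⟩ : Fin n) ∈ G.searchSet B u := by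
        intro x hx
        induction hx with
        | refl => exact ⟨u.2, .refl⟩
        | tail _ h2 ih =>
          obtain ⟨hb, h3⟩ := ih
          obtain ⟨_, _, hc, h4, h5⟩ := h2
          exact ⟨hc, h3.tail ⟨h4, h5⟩⟩
      intro hx
      exact (key v hx).2
    · intro hv
      have hv' : Relation.ReflTransGen (fun a b => G.Adj a b ∧ a ∉ B) u v := hv
      exact hv'.lift (fun x : Fin n => (x : ℕ))
        fun a b hab => ⟨by have := b.2; dsimp only; omega, a.2, b.2, hab.1, hab.2⟩
  have hS := h.search blockE r
  have h9 : ((search blockE r).sem σ).mem 9 = σ.mem 9 :=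
    Cmd.sem_mem (not_mem_wmems_search (by decide))
  rw [block, Cmd.sem_seq]
  generalize (search blockE r).sem σ = ρ at *
  obtain ⟨τ, hτ, -, hs⟩ := Cmd.loop_rule (x := 24) (b := 0)
    (c := .store 9 (.reg 24) (.bAnd (.cell 9 (.reg 24)) (.cell 7 (.reg 24)))) (σ := ρ)
    (fun i τ => ∀ a, τ.mem 9 a =
      if a < i then if ρ.mem 9 a ≠ 0 ∧ ρ.mem 7 a ≠ 0 then 1 else 0 else ρ.mem 9 a) hS.r0
    (by simp) (by
      intro i hi τ hf hI a
      have h7 : τ.mem 7 = ρ.mem 7 := hf.2 7 (by decide)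
      simp only [Cmd.sem, State.setCell_mem, if_true, State.setReg_mem, Function.update_apply,
        Expr.eval_bAnd, Expr.holds_cell, Expr.eval, State.setReg_reg, hI, h7]
      grind)
  rw [hs, State.setReg_mem, hτ, if_pos v.2, h9, hB]
  refine if_congr ?_ rfl rfl
  rw [hmark, Set.mem_inter_iff]
  refine and_congr ?_ Iff.rfl
  split_ifs with h1 <;> simp [h1]

open Classical in
/-- The two searches of `chainStep` compute `SimpleGraph.trim` of the layer. -/
lemma sem_chainStep (h : Setup n s t q p' (natAdj G) σ) {j : ℕ} (hj : σ.reg 12 = j) (hjn : j < n) :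
    (∀ v : Fin n, (chainStep.sem σ).mem 1 (j * n + v) =
      if v ∈ G.trim s t (layer n (σ.mem 5) j) then 1 else 0) ∧
    ∀ k < j * n, (chainStep.sem σ).mem 1 k = σ.mem 1 k := by
  rw [chainStep, Cmd.sem_seq, Cmd.sem_seq, Cmd.sem_seq]
  obtain ⟨τ, hτ, hf, hs⟩ := Cmd.loop_rule (x := 24) (b := 0)
    (c := .store 9 (.reg 24) (.bAnd (.bEq (.cell 5 (.reg 24)) (.reg 12))
      (.bEq (.cell 5 (.add (.reg 24) (.reg 0))) (.add (.reg 12) (.const 1))))) (σ := σ)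
    (fun i τ => ∀ a < i, τ.mem 9 a =
      if σ.mem 5 a = j ∧ σ.mem 5 (a + n) = j + 1 then 1 else 0) h.r0
    (by simp) (by
      intro i hi τ hf hI a ha
      have h5 : τ.mem 5 = σ.mem 5 := hf.2 5 (by decide)
      have h12 : τ.reg 12 = j := by rw [hf.1 12 (by decide), hj]
      have h0 : τ.reg 0 = n := by rw [hf.1 0 (by decide), h.r0]
      simp only [Cmd.sem, State.setCell_mem, if_true, State.setReg_mem, Function.update_apply,
        Expr.eval_bAnd, Expr.holds_bEq, Expr.eval, State.setReg_reg, h5]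
      simp only [h12, h0, reduceIte, Nat.reduceEqDiff]
      by_cases hai : a = i
      · subst hai; simp
      · rw [if_neg hai]; exact hI a (by omega))
  have hSτ := (h.frame (by decide) hf).setReg (x := 24) (v := n) (by decide)
  have h12 : (τ.setReg 24 n).reg 12 = j := by simp [hf.1 12 (by decide), hj]
  have h1 : (τ.setReg 24 n).mem 1 = σ.mem 1 := by simp [hf.2 1 (by decide)]
  rw [hs]
  have hB₁ : ∀ v : Fin n, (τ.setReg 24 n).mem 9 v =
      if v ∈ layer n (σ.mem 5) j then 1 else 0 := fun v => by
    rw [State.setReg_mem, hτ v v.2]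
    exact if_congr Iff.rfl rfl rfl
  generalize τ.setReg 24 n = σ₁ at *
  have hB₂ := sem_block hSτ (r := .reg 1) (u := s) (fun τ hτ => hτ.r1) hB₁
  have hS₂ : Setup n s t q p' (natAdj G) ((block (.reg 1)).sem σ₁) :=
    hSτ.frame (by decide) (Cmd.frame_sem _ _)
  have hB₃ := sem_block hS₂ (r := .reg 2) (u := t) (fun τ hτ => hτ.r2)
    (B := layer n (σ.mem 5) j ∩ G.searchSet (layer n (σ.mem 5) j) s)
    (fun v => by convert hB₂ v)
  have hS₃ : Setup n s t q p' (natAdj G) ((block (.reg 2)).sem ((block (.reg 1)).sem σ₁)) :=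
    hS₂.frame (by decide) (Cmd.frame_sem _ _)
  have h12₃ : ((block (.reg 2)).sem ((block (.reg 1)).sem σ₁)).reg 12 = j := by
    rw [Cmd.sem_reg (by decide), Cmd.sem_reg (by decide), h12]
  have h1₃ : ((block (.reg 2)).sem ((block (.reg 1)).sem σ₁)).mem 1 = σ.mem 1 := by
    rw [Cmd.sem_mem (by decide), Cmd.sem_mem (by decide), h1]
  generalize (block (.reg 2)).sem ((block (.reg 1)).sem σ₁) = σ₃ at *
  obtain ⟨ρ, hρ, -, hsρ⟩ := Cmd.loop_rule (x := 24) (b := 0)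
    (c := .store 1 (.add (.cell 3 (.reg 12)) (.reg 24)) (.cell 9 (.reg 24))) (σ := σ₃)
    (fun i τ => (∀ a < i, τ.mem 1 (j * n + a) = σ₃.mem 9 a) ∧
      ∀ k < j * n, τ.mem 1 k = σ.mem 1 k) hS₃.r0
    (by simp [h1₃]) (by
      rintro i hi τ hf ⟨hI, hI'⟩
      have h9 : τ.mem 9 = σ₃.mem 9 := hf.2 9 (by decide)
      have h12 : τ.reg 12 = j := by rw [hf.1 12 (by decide), h12₃]
      have h3 : τ.mem 3 j = j * n := by rw [hf.2 3 (by decide), hS₃.row j (by omega)]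
      simp only [Cmd.sem, State.setCell_mem, if_true, State.setReg_mem, Function.update_apply,
        Expr.eval, State.setReg_reg, h9]
      simp only [h12, h3, reduceIte, Nat.reduceEqDiff]
      refine ⟨fun a ha => ?_, fun k hk => ?_⟩
      · by_cases hai : a = i
        · subst hai; simp
        · rw [if_neg (by omega)]; exact hI a (by omega)
      · rw [if_neg (by omega)]; exact hI' k hk)
  rw [hsρ]
  exact ⟨fun v => (hρ.1 v v.2).trans (by unfold SimpleGraph.trim; convert hB₃ v), hρ.2⟩

open Classical in
lemma sem_loop_chainStep (h : Setup n s t q p' (natAdj G) σ) (hp : p' ≤ n) {j : ℕ} (hj : j < p')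
    (v : Fin n) : ((Cmd.loop 12 6 chainStep).sem σ).mem 1 (j * n + v) =
      if v ∈ G.trim s t (layer n (σ.mem 5) j) then 1 else 0 := by
  obtain ⟨ρ, hρ, -, hsρ⟩ := Cmd.loop_rule (x := 12) (b := 6) (c := chainStep) (σ := σ)
    (fun i τ => ∀ j < i, ∀ v : Fin n, τ.mem 1 (j * n + v) =
      if v ∈ G.trim s t (layer n (σ.mem 5) j) then 1 else 0) h.r6
    (by simp) (by
      intro i hi τ hf hI j hj v
      have hS := (h.frame (by decide) hf).setReg (x := 12) (v := i) (by decide)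
      obtain ⟨k1, k2⟩ := sem_chainStep hS (j := i) (by simp) (by omega)
      have h5 : (τ.setReg 12 i).mem 5 = σ.mem 5 := hf.2 5 (by decide)
      rw [h5] at k1
      by_cases hji : j = i
      · rw [hji]; exact k1 v
      · have : (j + 1) * n ≤ i * n := Nat.mul_le_mul_right _ (by omega)
        rw [k2 _ (by rw [Nat.add_mul] at this; omega)]
        exact hI j (by omega) v)
  rw [hsρ]
  exact hρ j hj v

end

end SeparatorPathDuality

/-! ### Output of the paths -/

namespace SeparatorPathDuality

open RAM SimpleGraph

/-- The test whether the nodes in registers `21` and `20` form an arc with flow. -/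
def supportE : Expr := .cell 4 (posE (.reg 21) (.reg 20))

/-- Extracts a path from the flow, and writes it as the path with the number in register `12`. The
search starts at `t`, so that the path is found in the order from `s` to `t`, and pushing a unit of
flow back along it removes the path from the flow. -/
def extractStep : Cmd :=
  .seq (search supportE (.reg 2))
  (.seq (.assign 14 (.add (.reg 1) (.reg 0)))
  (.seq (.assign 15 (.const 0))
  (.seq (.assign 16 (.cell 3 (.reg 12)))
  (.seq follow
  (.seq (.store 1 (.add (.reg 16) (.reg 15)) (.reg 2))
  (.store 2 (.reg 12) (.reg 15)))))))

section

variable {n q p' : ℕ} {G : SimpleGraph (Fin n)} {s t : Fin n} {σ : State}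

/-- The path `P` uses only edges with flow, and the flow `F₁` arises from `F₀` by removing one unit
of flow at least from every internal vertex of `P`. -/
structure Carried (F₀ F₁ : ℕ → ℕ → ℕ) (P : G.Path s t) : Prop where
  edge : ∀ k < P.1.length, F₀ (P.1.getVert k + n) (P.1.getVert (k + 1)) ≠ 0
  vertex : ∀ x ∈ P.1.support, x ≠ s → x ≠ t → F₁ x (x + n) + 1 ≤ F₀ x (x + n)

/-- The invariant of the extraction of a path, when `y` is the current node: the vertices before `y`
are recorded in `out` from the address `base` on, and one unit of flow is removed along the path
from the source to `y`. -/
structure ExtractInv (G : SimpleGraph (Fin n)) (s t : Fin n) (mark : ℕ → ℕ) (F₀ : ℕ → ℕ → ℕ)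
    (base : ℕ) (out₀ : ℕ → ℕ) (y : ℕ) (F : ℕ → ℕ → ℕ) (len : ℕ) (out : ℕ → ℕ) : Prop where
  le : ∀ a b, F a b ≤ F₀ a b
  net_eq : ∀ a, net n F a =
    net n F₀ a + (if a = s + n then 1 else 0) - (if a = y then 1 else 0)
  eq : ∀ a b, mark a < mark y ∨ mark b < mark y → F a b = F₀ a b
  out_eq : ∀ k < base, out k = out₀ k
  path : ∃ (v : Fin n) (w : G.Walk s v), w.IsPath ∧ w.length = len ∧
    ((y = v + n ∧ v ≠ t) ∨ y = v) ∧ (∀ k < len, out (base + k) = w.getVert k) ∧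
    (∀ x ∈ w.support, x ≠ v → x ≠ t ∧ mark y < mark (x + n)) ∧
    (∀ k < len, F₀ (w.getVert k + n) (w.getVert (k + 1)) ≠ 0) ∧
    ∀ x ∈ w.support, x ≠ s → x ≠ v ∨ y = v + n → F x (x + n) + 1 ≤ F₀ x (x + n)

lemma getVert_concat_of_le {V : Type*} {G : SimpleGraph V} {u v w : V} (p : G.Walk u v)
    (h : G.Adj v w) {k : ℕ} (hk : k ≤ p.length) : (p.concat h).getVert k = p.getVert k := by
  rw [Walk.concat_eq_append, Walk.getVert_append', if_pos hk]

lemma getVert_concat_length {V : Type*} {G : SimpleGraph V} {u v w : V} (p : G.Walk u v)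
    (h : G.Adj v w) : (p.concat h).getVert (p.length + 1) = w := by
  rw [← Walk.length_concat p h, Walk.getVert_length]

lemma ExtractInv.step {mark par : ℕ → ℕ} {F₀ F : ℕ → ℕ → ℕ} {base y len : ℕ} {out₀ out : ℕ → ℕ}
    (harc : ∀ a b, F₀ a b ≠ 0 → Arc n (natAdj G) a b)
    (T : SearchTree (fun a b => F₀ b a ≠ 0) (2 * n) t mark par)
    (hy : y < 2 * n) (hyt : y ≠ t) (hmy : mark y ≠ 0)
    (h : ExtractInv G s t mark F₀ base out₀ y F len out) :
    ExtractInv G s t mark F₀ base out₀ (par y) (push F (par y) y)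
      (if n ≤ y then len + 1 else len)
      (if n ≤ y then Function.update out (base + len) (y - n) else out) := by
  have hm1 : mark y ≠ 1 := fun h1 => hyt (T.eq_root y hy h1)
  obtain ⟨hx, hmx, hf⟩ := T.parent y hy (by omega)
  have harc' := harc _ _ hf
  have hFx : F y (par y) = F₀ y (par y) := h.eq _ _ (Or.inr (by omega))
  have hne : par y ≠ y := by intro h1; rw [h1] at hmx; omega
  have hpush : ∀ a b, push F (par y) y a b =
      if a = y ∧ b = par y then F a b - 1 else F a b := by
    intro a b; simp [push, hFx, hf]
  have hle : ∀ a b, push F (par y) y a b ≤ F a b := by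
    intro a b; rw [hpush]; split_ifs <;> omega
  refine ⟨fun a b => (hle a b).trans (h.le a b), fun a => ?_, fun a b hab => ?_, fun k hk => ?_, ?_⟩
  · rw [net_push hx hy hne, h.net_eq]; ring
  · rw [push_apply_of_ne, h.eq a b (by omega)]
    · rintro ⟨rfl, rfl⟩; omega
    · rintro ⟨rfl, rfl⟩; omega
  · split_ifs
    · rw [Function.update_of_ne (by omega), h.out_eq k hk]
    · exact h.out_eq k hk
  · obtain ⟨v, w, hw, hlen, hyv, hout, hsup, hedge, hvert⟩ := h.path
    have hv := v.2
    rcases hyv with ⟨hyv, hvt⟩ | hyv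
    · -- an out-node: the path continues with an edge to the in-node of a new vertex
      rw [if_pos (by omega), if_pos (by omega)]
      obtain ⟨v', hv', hadj⟩ : ∃ v' : Fin n, par y = v' ∧ G.Adj v v' := by
        rcases harc' with ⟨u, v', huv, h1, h2⟩ | ⟨h1, -⟩
        · obtain ⟨hu, hv', huv⟩ := huv
          refine ⟨⟨v', hv'⟩, h2, ?_⟩
          have : v = ⟨u, hu⟩ := Fin.ext (by simp only; omega)
          rwa [this]
        · omega
      have hnot : v' ∉ w.support := by
        -- the successor of `v'` in the search tree is its out-node, but if the walk has already
        -- passed `v'`, then this out-node has a higher level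
        intro hmem
        obtain ⟨h1, h2⟩ := hsup v' hmem hadj.ne'
        have h3 : mark v' ≠ 1 := fun h3 => h1 (Fin.ext (T.eq_root v' (by omega) h3))
        rw [hv'] at hmx
        obtain ⟨h4, h5, h6⟩ := T.parent v' (by omega) (by omega)
        have h7 : par v' = v' + n := by
          rcases harc _ _ h6 with ⟨u, _, _, h8, _⟩ | ⟨_, h8⟩
          · have := v'.2; omega
          · exact h8
        rw [h7] at h5
        omega
      refine ⟨v', w.concat hadj, hw.concat hnot hadj, by rw [Walk.length_concat, hlen],
        Or.inr hv', fun k hk => ?_, fun x hx hxv => ?_, fun k hk => ?_, fun x hx hxs hxv => ?_⟩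
      · rw [getVert_concat_of_le w hadj (by omega)]
        by_cases hkl : k = len
        · rw [hkl, Function.update_self, ← hlen, Walk.getVert_length]; omega
        · rw [Function.update_of_ne (by omega), hout k (by omega)]
      · rw [Walk.support_concat, List.mem_append, List.mem_singleton] at hx
        have hx := hx.resolve_right hxv
        by_cases hxv : x = v
        · rw [hxv, ← hyv]; exact ⟨hvt, by omega⟩
        · obtain ⟨h1, h2⟩ := hsup x hx hxv
          exact ⟨h1, by omega⟩
      · rw [getVert_concat_of_le w hadj (by omega)]
        by_cases hkl : k = len
        · rw [hkl, ← hlen, getVert_concat_length, Walk.getVert_length, ← hyv, ← hv']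
          exact hf
        · rw [getVert_concat_of_le w hadj (by omega)]
          exact hedge k (by omega)
      · rw [Walk.support_concat, List.mem_append, List.mem_singleton] at hx
        have h1 : x ≠ v' := hxv.resolve_right (by have := v'.2; omega)
        exact (Nat.add_le_add_right (hle _ _) 1).trans
          (hvert x (hx.resolve_right h1) hxs (Or.inr hyv))
    · -- an in-node: the path continues to the out-node of the same vertex
      rw [if_neg (by omega), if_neg (by omega)]
      have hpar : par y = v + n := by
        rcases harc' with ⟨u, _, _, h1, _⟩ | ⟨_, h1⟩
        · omega
        · rw [h1, hyv]
      have hvt : v ≠ t := by rintro rfl; exact hyt hyv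
      refine ⟨v, w, hw, hlen, Or.inl ⟨hpar, hvt⟩, hout, fun x hx hxv => ?_, hedge,
        fun x hx hxs _ => ?_⟩
      · obtain ⟨h1, h2⟩ := hsup x hx hxv
        exact ⟨h1, by omega⟩
      · by_cases hxv : x = v
        · subst hxv
          rw [hpush, if_pos ⟨hyv.symm, hpar.symm⟩, ← hpar, ← hyv, hFx]
          omega
        · exact (Nat.add_le_add_right (hle _ _) 1).trans (hvert x hx hxs (Or.inl hxv))

lemma sem_follow_support (h : Setup n s t q p' (natAdj G) σ) (hst : s ≠ t) {F : ℕ → ℕ → ℕ}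
    {val : ℤ} (hF : ∀ a < 2 * n, ∀ b < 2 * n, σ.mem 4 (pos n a b) = F a b)
    (hflow : IsFlow n (natAdj G) s t val F) (hval : 0 < val)
    (T : SearchTree (fun a b => F b a ≠ 0) (2 * n) t (σ.mem 7) (σ.mem 8))
    (h13 : σ.reg 13 = t) (h14 : σ.reg 14 = s + n) (h15 : σ.reg 15 = 0) {base : ℕ}
    (h16 : σ.reg 16 = base) :
    ∃ (F' : ℕ → ℕ → ℕ) (P : G.Path s t),
      (∀ a < 2 * n, ∀ b < 2 * n, (follow.sem σ).mem 4 (pos n a b) = F' a b) ∧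
      IsFlow n (natAdj G) s t (val - 1) F' ∧ (∀ a b, F' a b ≤ F a b) ∧ Carried F F' P ∧
      (follow.sem σ).reg 15 = P.1.length ∧
      (∀ k < P.1.length, (follow.sem σ).mem 1 (base + k) = P.1.getVert k) ∧
      ∀ k < base, (follow.sem σ).mem 1 k = σ.mem 1 k := by
  have hreach : σ.mem 7 (s + n) ≠ 0 := by
    have h1 := hflow.source_mem hval
      ((Finset.range (2 * n)).filter fun a => σ.mem 7 a ≠ 0) (Finset.filter_subset _ _)
      (by
        rw [Finset.mem_filter, Finset.mem_range, T.mark_root]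
        exact ⟨by omega, by omega⟩)
      (fun a ha b hb hf => by
        rw [Finset.mem_filter, Finset.mem_range] at ha ⊢
        exact ⟨hb, T.closed a ha.1 b hb ha.2 hf⟩)
    exact (Finset.mem_filter.1 h1).2
  obtain ⟨F', hinv, hF'⟩ := sem_follow h rfl T h13 h14 (by omega) hreach h16 hF
    (ExtractInv G s t (σ.mem 7) F base (σ.mem 1)) (by
      refine ⟨fun _ _ => le_rfl, by simp, fun _ _ _ => rfl, fun _ _ => rfl, s, .nil, by simp,
        by simp [h15], Or.inl ⟨rfl, hst⟩, by simp [h15], ?_, by simp [h15], ?_⟩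
      · intro x hx hxs
        simp at hx; exact absurd hx hxs
      · intro x hx hxs
        simp at hx; exact absurd hx hxs)
    (fun y F' len out hy hm hyt _ _ _ hJ => hJ.step hflow.arc T hy hyt hm)
  obtain ⟨v, w, hw, hlen, hvt, hout, -, hedge, hvert⟩ := hinv.path
  have hv : v = t := by
    rcases hvt with ⟨h1, -⟩ | h1
    · omega
    · exact Fin.ext h1.symm
  subst hv
  rw [← hlen] at hout hedge
  refine ⟨F', ⟨w, hw⟩, hF', ⟨fun a b h0 => hflow.arc a b ?_, fun a ha => ?_⟩, hinv.le,
    ⟨hedge, fun x hx hxs hxv => hvert x hx hxs (Or.inl hxv)⟩, hlen.symm, hout, hinv.out_eq⟩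
  · have := hinv.le a b; omega
  · rw [hinv.net_eq, hflow.net_eq a ha]; ring

lemma sem_extractStep (h : Setup n s t q p' (natAdj G) σ) (hst : s ≠ t) {F : ℕ → ℕ → ℕ}
    {val : ℤ} (hF : ∀ a < 2 * n, ∀ b < 2 * n, σ.mem 4 (pos n a b) = F a b)
    (hflow : IsFlow n (natAdj G) s t val F) (hval : 0 < val) {i : ℕ} (hi : σ.reg 12 = i)
    (hiq : i < q) :
    ∃ (F' : ℕ → ℕ → ℕ) (P : G.Path s t),
      (∀ a < 2 * n, ∀ b < 2 * n, (extractStep.sem σ).mem 4 (pos n a b) = F' a b) ∧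
      IsFlow n (natAdj G) s t (val - 1) F' ∧ (∀ a b, F' a b ≤ F a b) ∧ Carried F F' P ∧
      (extractStep.sem σ).mem 2 i = P.1.length ∧
      (∀ k ≤ P.1.length, (extractStep.sem σ).mem 1 (i * n + k) = P.1.getVert k) ∧
      (∀ k < i * n, (extractStep.sem σ).mem 1 k = σ.mem 1 k) ∧
      ∀ k < i, (extractStep.sem σ).mem 2 k = σ.mem 2 k := by
  obtain ⟨T, h13⟩ := sem_search h (e := supportE) (r := .reg 2) (root := t)
    (R := fun a b => F b a ≠ 0)
    (fun τ hτ hm a ha b hb h20 h21 => by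
      have h1 : (posE (.reg 21) (.reg 20)).eval τ = pos n b a := by
        rw [hτ.eval_posE (by simpa [Expr.eval, h21] using hb)]; simp [Expr.eval, h20, h21]
      rw [supportE, Expr.holds_cell, h1, hm 4 (by decide), hF b hb a ha])
    (fun τ hτ => hτ.r2) (by omega)
  rw [extractStep, Cmd.sem_seq, Cmd.sem_seq, Cmd.sem_seq, Cmd.sem_seq, Cmd.sem_seq, Cmd.sem_seq]
  have hS := h.search supportE (.reg 2)
  have f12 : ((search supportE (.reg 2)).sem σ).reg 12 = i := by
    rw [Cmd.sem_reg (not_mem_wregs_search (by decide)), hi]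
  have fm : ∀ a ∉ [6, 7, 8], ((search supportE (.reg 2)).sem σ).mem a = σ.mem a :=
    fun a ha => Cmd.sem_mem (not_mem_wmems_search ha)
  generalize (search supportE (.reg 2)).sem σ = σ₁ at *
  obtain ⟨σ₂, hσ₂⟩ : ∃ τ, τ = (Cmd.assign 16 (.cell 3 (.reg 12))).sem
    ((Cmd.assign 15 (.const 0)).sem ((Cmd.assign 14 (.add (.reg 1) (.reg 0))).sem σ₁)) := ⟨_, rfl⟩
  have hS₂ : Setup n s t q p' (natAdj G) σ₂ := by
    rw [hσ₂]
    exact ((hS.setReg (by decide)).setReg (by decide)).setReg (by decide)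
  have hm₂ : σ₂.mem = σ₁.mem := by rw [hσ₂]; rfl
  have e13 : σ₂.reg 13 = t := by
    rw [hσ₂, Cmd.sem_reg (by decide), Cmd.sem_reg (by decide), Cmd.sem_reg (by decide), h13]
  have e12 : σ₂.reg 12 = i := by
    rw [hσ₂, Cmd.sem_reg (by decide), Cmd.sem_reg (by decide), Cmd.sem_reg (by decide), f12]
  have e14 : σ₂.reg 14 = s + n := by
    rw [hσ₂, Cmd.sem_reg (by decide), Cmd.sem_reg (by decide)]
    simp [Cmd.sem, Expr.eval, hS.r0, hS.r1]
  have e15 : σ₂.reg 15 = 0 := by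
    rw [hσ₂, Cmd.sem_reg (by decide)]
    simp [Cmd.sem, Expr.eval]
  have e16 : σ₂.reg 16 = i * n := by
    rw [hσ₂]
    simp [Cmd.sem, Expr.eval, f12, hS.row i (by omega)]
  rw [← hσ₂]
  clear hσ₂
  obtain ⟨F', P, k1, k2, k3, k4, k5, k6, k7⟩ := sem_follow_support hS₂ hst (F := F)
    (by rw [hm₂, fm 4 (by decide)]; exact hF) hflow hval (by rw [hm₂]; exact T) e13 e14 e15 e16
  have g16 : (follow.sem σ₂).reg 16 = i * n := by rw [Cmd.sem_reg (by decide), e16]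
  have g12 : (follow.sem σ₂).reg 12 = i := by rw [Cmd.sem_reg (by decide), e12]
  have g2 : (follow.sem σ₂).reg 2 = t := by rw [Cmd.sem_reg (by decide), hS₂.r2]
  have gm : (follow.sem σ₂).mem 2 = σ.mem 2 := by
    rw [Cmd.sem_mem (by decide), hm₂, fm 2 (by decide)]
  rw [hm₂, fm 1 (by decide)] at k7
  generalize follow.sem σ₂ = ρ at *
  refine ⟨F', P, ?_, k2, k3, k4, ?_, ?_, ?_, ?_⟩
  · simpa [Cmd.sem] using k1
  · simp [Cmd.sem, Expr.eval, g12, k5]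
  · intro k hk
    simp only [Cmd.sem, State.setCell_mem, Expr.eval, g16, k5, g2]
    by_cases hkl : k = P.1.length
    · rw [hkl]; simp
    · simpa [hkl] using k6 k (by omega)
  · intro k hk
    simp only [Cmd.sem, State.setCell_mem, Expr.eval, g16, k5, g2]
    have : k ≠ i * n + P.1.length := by omega
    simpa [this] using k7 k hk
  · intro k hk
    simp [Cmd.sem, Expr.eval, g12, gm, hk.ne]

/-- The extraction of `q` paths from a flow of value `q`. An internal vertex of two of the paths
carries at least two units of flow. -/
lemma sem_loop_extractStep (h : Setup n s t q p' (natAdj G) σ) (hst : s ≠ t) (hG : G.Connected)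
    {F : ℕ → ℕ → ℕ} (hF : ∀ a < 2 * n, ∀ b < 2 * n, σ.mem 4 (pos n a b) = F a b)
    (hflow : IsFlow n (natAdj G) s t q F) :
    ∃ P : ℕ → G.Path s t,
      (∀ i < q, ((Cmd.loop 12 4 extractStep).sem σ).mem 2 i = (P i).1.length ∧
        ∀ k ≤ (P i).1.length,
          ((Cmd.loop 12 4 extractStep).sem σ).mem 1 (i * n + k) = (P i).1.getVert k) ∧
      (∀ i < q, ∃ F', Carried F F' (P i)) ∧
      ∀ i < q, ∀ j < q, i ≠ j → ∀ x ∈ (P i).1.support, x ∈ (P j).1.support → x ≠ s → x ≠ t →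
        2 ≤ F x (x + n) := by
  obtain ⟨w, hw⟩ := (hG.preconnected s t).exists_isPath
  obtain ⟨ρ, ⟨F', P, -, -, -, h1, h2, h3⟩, -, hsρ⟩ := Cmd.loop_rule (x := 12) (b := 4)
    (c := extractStep) (σ := σ)
    (fun i τ => ∃ (F' : ℕ → ℕ → ℕ) (P : ℕ → G.Path s t),
      (∀ a < 2 * n, ∀ b < 2 * n, τ.mem 4 (pos n a b) = F' a b) ∧
      IsFlow n (natAdj G) s t (q - i) F' ∧ (∀ a b, F' a b ≤ F a b) ∧
      (∀ j < i, τ.mem 2 j = (P j).1.length ∧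
        ∀ k ≤ (P j).1.length, τ.mem 1 (j * n + k) = (P j).1.getVert k) ∧
      (∀ j < i, Carried F F' (P j)) ∧
      ∀ j < i, ∀ j' < j, ∀ x ∈ (P j).1.support, x ∈ (P j').1.support → x ≠ s → x ≠ t →
        2 ≤ F x (x + n)) h.r4
    ⟨F, fun _ => ⟨w, hw⟩, hF, by simpa using hflow, fun _ _ => le_rfl, by simp, by simp,
      by simp⟩ (by
      rintro i hi τ hf ⟨F', P, i1, i2, i3, i4, i5, i6⟩
      have hS := (h.frame (by decide) hf).setReg (x := 12) (v := i) (by decide)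
      obtain ⟨F₂, P', k1, k2, k3, k4, k5, k6, k7, k8⟩ := sem_extractStep hS hst (F := F')
        (by simpa using i1) i2 (by omega) (i := i) (by simp) hi
      refine ⟨F₂, Function.update P i P', k1, ?_, fun a b => (k3 a b).trans (i3 a b),
        fun j hj => ?_, fun j hj => ?_, fun j hj j' hj' x hx hx' hxs hxt => ?_⟩
      · have : ((q : ℤ) - (i + 1 : ℕ)) = q - i - 1 := by push_cast; ring
        rw [this]; exact k2
      · by_cases hji : j = i
        · subst hji
          rw [Function.update_self]
          exact ⟨k5, k6⟩
        · rw [Function.update_of_ne hji]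
          obtain ⟨l1, l2⟩ := i4 j (by omega)
          refine ⟨by rw [k8 j (by omega)]; exact l1, fun k hk => ?_⟩
          have hlt := (P j).2.length_lt
          rw [Fintype.card_fin] at hlt
          have : (j + 1) * n ≤ i * n := Nat.mul_le_mul_right _ (by omega)
          rw [k7 _ (by rw [Nat.add_mul] at this; omega)]
          exact l2 k hk
      · by_cases hji : j = i
        · subst hji
          rw [Function.update_self]
          refine ⟨fun k hk => ?_, fun x hx hxs hxt => (k4.vertex x hx hxs hxt).trans (i3 _ _)⟩
          have l1 := k4.edge k hk
          have l2 := i3 (P'.1.getVert k + n) (P'.1.getVert (k + 1))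
          omega
        · rw [Function.update_of_ne hji]
          have l := i5 j (by omega)
          exact ⟨l.edge, fun x hx hxs hxt =>
            (Nat.add_le_add_right (k3 _ _) 1).trans (l.vertex x hx hxs hxt)⟩
      · rw [Function.update_of_ne (show j' ≠ i by omega)] at hx'
        by_cases hji : j = i
        · subst hji
          rw [Function.update_self] at hx
          have l1 := k4.vertex x hx hxs hxt
          have l2 := (i5 j' (by omega)).vertex x hx' hxs hxt
          omega
        · rw [Function.update_of_ne hji] at hx
          exact i6 j (by omega) j' hj' x hx hx' hxs hxt)
  rw [hsρ]
  refine ⟨P, h1, fun i hi => ⟨F', h2 i hi⟩, fun i hi j hj hij x hx hx' hxs hxt => ?_⟩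
  rcases lt_or_gt_of_ne hij with h4 | h4
  · exact h3 j hj i h4 x hx' hx hxs hxt
  · exact h3 i hi j h4 x hx hx' hxs hxt

/-- Along a path that carries flow, the potential does not decrease, and it increases at the
vertices that carry at least two units of flow. Hence there are at most `π t` such vertices. -/
lemma IsPotential.ncard_le {F F' : ℕ → ℕ → ℕ} {π : ℕ → ℕ} (h : IsPotential n (natAdj G) F π)
    {P : G.Path s t} (hP : Carried F F' P) {S : Set (Fin n)}
    (hS : ∀ x ∈ S, x ∈ P.1.support ∧ x ≠ s ∧ x ≠ t ∧ 2 ≤ F x (x + n)) : S.ncard ≤ π t := by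
  have hedge : ∀ k < P.1.length, π (P.1.getVert k + n) = π (P.1.getVert (k + 1)) := fun k hk => by
    have h1 := natAdj_fin.2 (P.1.adj_getVert_succ hk)
    exact le_antisymm (h.edge_flow _ _ h1 (hP.edge k hk)) (h.edge _ _ h1)
  have hmono : ∀ k m, k < m → m ≤ P.1.length →
      π (P.1.getVert k + n) ≤ π (P.1.getVert m) := by
    intro k m hkm
    induction m, hkm using Nat.le_induction with
    | base => intro hm; exact (hedge k (by omega)).le
    | succ m hkm ih =>
      intro hm
      refine (ih (by omega)).trans ?_
      rw [← hedge m (by omega)]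
      refine h.vertex_one _ (P.1.getVert m).2 ?_
      have := hP.vertex (P.1.getVert m) (P.1.getVert_mem_support m)
        (fun h0 => by
          have h1 := P.2.getVert_injOn (x₁ := m) (x₂ := 0) (by simp; omega) (by simp)
            (by rw [h0, Walk.getVert_zero])
          omega)
        (fun h0 => by
          have h1 := P.2.getVert_injOn (x₁ := m) (x₂ := P.1.length) (by simp; omega) (by simp)
            (by rw [h0, Walk.getVert_length])
          omega)
      omega
  have hidx : ∀ x ∈ S, ∃ k < P.1.length, P.1.getVert k = x := fun x hx => by
    obtain ⟨h1, -, h3, -⟩ := hS x hx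
    obtain ⟨k, hk, hkl⟩ := Walk.mem_support_iff_exists_getVert.1 h1
    refine ⟨k, lt_of_le_of_ne hkl ?_, hk⟩
    rintro rfl
    exact h3 (by rw [← hk, Walk.getVert_length])
  have hrise : ∀ x ∈ S, π x + 1 ≤ π (x + n) := fun x hx => h.vertex_two x x.2 (hS x hx).2.2.2
  have hcard := Set.ncard_le_ncard_of_injOn (t := (Finset.Icc 1 (π t) : Set ℕ))
    (fun x : Fin n => π (x + n)) (fun x hx => by
      obtain ⟨k, hk, rfl⟩ := hidx x hx
      have h1 := hrise _ hx
      have h2 := hmono k _ hk le_rfl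
      rw [Walk.getVert_length] at h2
      simp only [Finset.coe_Icc, Set.mem_Icc]
      omega) (fun x hx y hy hxy => by
      obtain ⟨k, hk, rfl⟩ := hidx x hx
      obtain ⟨m, hm, rfl⟩ := hidx y hy
      have h1 := hrise _ hx
      have h2 := hrise _ hy
      simp only at hxy
      rcases lt_trichotomy k m with h3 | h3 | h3
      · have := hmono k m h3 hm.le; omega
      · rw [h3]
      · have := hmono m k h3 hk.le; omega) (Finset.finite_toSet _)
  rwa [Set.ncard_coe_finset, Nat.card_Icc, Nat.add_sub_cancel] at hcard

end

end SeparatorPathDuality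

/-! ### The algorithm -/

namespace SeparatorPathDuality

open RAM SimpleGraph

/-- Computes `2n`, `p' = min p n`, and `2n + q`. The truncated difference `p - (p - n)` is the
minimum. -/
def sizes : Cmd :=
  .seq (.assign 5 (.add (.reg 0) (.reg 0)))
  (.seq (.assign 6 (.sub (.reg 3) (.sub (.reg 3) (.reg 0))))
  (.assign 7 (.add (.reg 5) (.reg 4))))

/-- Computes the multiples of `n`. -/
def rows : Cmd :=
  .loop 11 7 (.seq (.store 3 (.reg 11) (.reg 10)) (.assign 10 (.add (.reg 10) (.reg 0))))

/-- Computes the flow and the potentials, and from these the separators or the paths. -/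
def compute : Cmd :=
  .seq rows (.seq (.loop 12 7 augmentStep)
    (.ite (.sub (.reg 4) (.reg 8)) (.loop 12 6 chainStep) (.loop 12 4 extractStep)))

/-- Sets the flag for the kind of the output. -/
def finish : Cmd := .assign 0 (.bLe (.reg 4) (.reg 8))

/-- The program of the algorithm. -/
def program : Program := .seq sizes.compile (.seq compute.compile finish.compile)

/-- The time bound of the algorithm; all loop bounds are at most twice the size parameter. -/
noncomputable def programTime : Polynomial ℕ :=
  (sizes.time + (compute.time + finish.time)).comp (2 * Polynomial.X)

section

variable {n : ℕ} {G : SimpleGraph (Fin n)} {s t : Fin n} {p q : ℕ}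

lemma sem_rows {σ : State} (h0 : σ.reg 0 = n) (h10 : σ.reg 10 = 0) {T : ℕ} (h7 : σ.reg 7 = T) :
    ∀ a < T, (rows.sem σ).mem 3 a = a * n := by
  obtain ⟨ρ, ⟨-, hρ⟩, -, hs⟩ := Cmd.loop_rule (x := 11) (b := 7)
    (c := .seq (.store 3 (.reg 11) (.reg 10)) (.assign 10 (.add (.reg 10) (.reg 0)))) (σ := σ)
    (fun i τ => τ.reg 10 = i * n ∧ ∀ a < i, τ.mem 3 a = a * n) h7 (by simp [h10]) (by
      rintro i hi τ hf ⟨h1, h2⟩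
      have h0' : τ.reg 0 = n := by rw [hf.1 0 (by decide), h0]
      refine ⟨by simp [Cmd.sem, Expr.eval, h1, h0']; ring, fun a ha => ?_⟩
      by_cases hai : a = i
      · subst hai; simp [Cmd.sem, Expr.eval, h1]
      · simpa [Cmd.sem, Expr.eval, hai] using h2 a (by omega))
  rw [rows, hs]
  exact hρ

lemma input_adj (u : ℕ) (hu : u < n) (v : ℕ) (hv : v < n) :
    (input G s t p q).mem 0 (u * n + v) ≠ 0 ↔ natAdj G u v := by
  simp only [input, true_and, ne_eq, ite_eq_right_iff, one_ne_zero, imp_false, not_not]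
  constructor
  · rintro ⟨u', v', h1, h2⟩
    have h3 : u = u' := by
      have e1 : (u * n + v) / n = u := by
        rw [Nat.mul_comm, Nat.mul_add_div (by omega), Nat.div_eq_of_lt hv, Nat.add_zero]
      have e2 : ((u' : ℕ) * n + v') / n = u' := by
        rw [Nat.mul_comm, Nat.mul_add_div (by omega), Nat.div_eq_of_lt v'.2, Nat.add_zero]
      rw [← e1, ← e2, h2]
    subst h3
    have h4 : v = v' := by omega
    subst h4
    exact natAdj_fin.2 h1
  · rintro ⟨_, _, h⟩
    exact ⟨_, _, h, rfl⟩

lemma setup_rows :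
    Setup n s t q (min p n) (natAdj G) (rows.sem (sizes.sem (input G s t p q))) := by
  have h0 : (sizes.sem (input G s t p q)).reg 0 = n := by
    rw [Cmd.sem_reg (by decide)]; rfl
  have h10 : (sizes.sem (input G s t p q)).reg 10 = 0 := by
    rw [Cmd.sem_reg (by decide)]; rfl
  have h7 : (sizes.sem (input G s t p q)).reg 7 = 2 * n + q := by
    simp [sizes, Cmd.sem, Expr.eval, input]; ring
  refine ⟨?_, ?_, ?_, ?_, ?_, ?_, ?_, ?_, sem_rows h0 h10 h7⟩
  · rw [Cmd.sem_reg (by decide), h0]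
  · rw [Cmd.sem_reg (by decide), Cmd.sem_reg (by decide)]; rfl
  · rw [Cmd.sem_reg (by decide), Cmd.sem_reg (by decide)]; rfl
  · rw [Cmd.sem_reg (by decide), Cmd.sem_reg (by decide)]; rfl
  · rw [Cmd.sem_reg (by decide)]
    simp [sizes, Cmd.sem, Expr.eval, input]; ring
  · rw [Cmd.sem_reg (by decide)]
    simp [sizes, Cmd.sem, Expr.eval, input]; omega
  · rw [Cmd.sem_reg (by decide), h7]
  · rw [Cmd.sem_mem (by decide), Cmd.sem_mem (by decide)]
    exact input_adj

/-- Initially, the flow and all potentials are zero. -/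
lemma optimal_rows :
    Optimal n s t (natAdj G) (fun _ _ => 0) (rows.sem (sizes.sem (input G s t p q))) ∧
      (rows.sem (sizes.sem (input G s t p q))).reg 8 = 0 ∧
      (rows.sem (sizes.sem (input G s t p q))).reg 9 = 0 := by
  have h4 : (rows.sem (sizes.sem (input G s t p q))).mem 4 = fun _ => 0 := by
    rw [Cmd.sem_mem (by decide), Cmd.sem_mem (by decide)]; simp [input]
  have h5 : (rows.sem (sizes.sem (input G s t p q))).mem 5 = fun _ => 0 := by
    rw [Cmd.sem_mem (by decide), Cmd.sem_mem (by decide)]; simp [input]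
  have h8 : (rows.sem (sizes.sem (input G s t p q))).reg 8 = 0 := by
    rw [Cmd.sem_reg (by decide), Cmd.sem_reg (by decide)]; rfl
  have h9 : (rows.sem (sizes.sem (input G s t p q))).reg 9 = 0 := by
    rw [Cmd.sem_reg (by decide), Cmd.sem_reg (by decide)]; rfl
  refine ⟨⟨?_, ⟨?_, ?_⟩, ?_, ?_, ?_⟩, h8, h9⟩
  · simp [h4]
  · simp
  · simp [h8, net]
  · rw [h5]; constructor <;> simp
  · rw [h5]
  · rw [h5, h9]

/-- The result of the main part of the algorithm. -/
lemma sem_compute (hG : G.Connected) (hst : s ≠ t) (σ : State)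
    (hσ : σ = compute.sem (sizes.sem (input G s t p q))) :
    (σ.reg 8 < σ.reg 4 ∧ ∃ C : Fin p → Finset (Fin n),
      (∀ (j : Fin p) (v : Fin n), σ.mem 1 ((j : ℕ) * n + v) = if v ∈ C j then 1 else 0) ∧
      G.IsSeparatorChain s t (fun j => (C j : Set (Fin n))) ∧ ∀ j, (C j).card ≤ q) ∨
    (σ.reg 4 ≤ σ.reg 8 ∧ ∃ P : Fin q → G.Path s t,
      (∀ i : Fin q, σ.mem 2 i = (P i).1.length ∧
        ∀ k ≤ (P i).1.length, σ.mem 1 ((i : ℕ) * n + k) = ((P i).1.getVert k : ℕ)) ∧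
      ∀ i, (sharedInternalVertices P i).ncard ≤ p) := by
  classical
  have hA : ∀ u v, natAdj G u v → u < n ∧ v < n ∧ u ≠ v := fun _ _ => natAdj_lt
  obtain ⟨hO, h8, h9⟩ := optimal_rows (G := G) (s := s) (t := t) (p := p) (q := q)
  have hS := setup_rows (G := G) (s := s) (t := t) (p := p) (q := q)
  obtain ⟨F, hO₁, hval, hle, hD⟩ :=
    sem_loop_augmentStep hA hS hO s.2 t.2 (min_le_right _ _) h8 h9
  rw [compute, Cmd.sem_seq, Cmd.sem_seq] at hσ
  have hS₁ : Setup n s t q (min p n) (natAdj G)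
      ((Cmd.loop 12 7 augmentStep).sem (rows.sem (sizes.sem (input G s t p q)))) :=
    hS.frame (by decide) (Cmd.frame_sem _ _)
  generalize (Cmd.loop 12 7 augmentStep).sem
    (rows.sem (sizes.sem (input G s t p q))) = ρ at *
  have hcond : (Expr.sub (.reg 4) (.reg 8)).holds ρ ↔ ρ.reg 8 < q := by
    simp [Expr.eval, hS₁.r4]
  rw [Cmd.sem] at hσ
  by_cases hq : ρ.reg 8 < q
  · left
    rw [if_pos (hcond.2 hq)] at hσ
    have hDn := hO₁.pot.lt_card hG hst hO₁.source hO₁.sink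
    have hpD := hD hq
    have hp : min p n = p := by omega
    rw [hp] at hpD hS₁
    refine ⟨?_, fun j => Finset.univ.filter fun v => v ∈ G.trim s t (layer n (ρ.mem 5) j),
      fun j v => ?_, ?_, fun j => ?_⟩
    · rw [hσ, Cmd.sem_reg (by decide), Cmd.sem_reg (by decide), hS₁.r4]; exact hq
    · rw [hσ, sem_loop_chainStep hS₁ (by omega) j.2 v]
      simp
    · simpa using hO₁.pot.isSeparatorChain hst hO₁.source hO₁.sink hpD
    · refine (hO₁.pot.card_layer_le hO₁.flow hO₁.source hO₁.sink (i := j)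
        (by have := j.2; omega) ?_).trans hval
      intro v hv
      simp only [Finset.coe_filter, Finset.mem_univ, true_and] at hv
      exact trim_subset hv
  · right
    rw [if_neg (fun h => hq (hcond.1 h))] at hσ
    have hvq : ρ.reg 8 = q := by omega
    obtain ⟨P, h1, h2, h3⟩ := sem_loop_extractStep hS₁ hst hG hO₁.rep (hvq ▸ hO₁.flow)
    refine ⟨?_, fun i => P i, fun i => ?_, fun i => ?_⟩
    · rw [hσ, Cmd.sem_reg (by decide), Cmd.sem_reg (by decide), hS₁.r4]; omega
    · rw [hσ]; exact h1 i i.2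
    · obtain ⟨F', hF'⟩ := h2 i i.2
      refine (hO₁.pot.ncard_le hF' fun x hx => ?_).trans
        (by rw [hO₁.sink]; exact hle.trans (min_le_left _ _))
      obtain ⟨⟨hx1, hx2⟩, hx3⟩ := hx
      simp only [Set.mem_insert_iff, Set.mem_singleton_iff, not_or] at hx3
      simp only [Set.mem_iUnion] at hx2
      obtain ⟨j, hj, hx2⟩ := hx2
      exact ⟨hx1, hx3.1, hx3.2,
        h3 i i.2 j j.2 (fun h => hj (Fin.ext h.symm)) x hx1 hx2 hx3.1 hx3.2⟩

theorem exec_program (hG : G.Connected) (hst : s ≠ t) :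
    ∃ (k : ℕ) (σ : State), Exec program (input G s t p q) k σ ∧
      k ≤ programTime.eval (n + Nat.size p + q) ∧
      ((∃ C : Fin p → Finset (Fin n), OutputsSets σ C ∧
          G.IsSeparatorChain s t (fun j => (C j : Set (Fin n))) ∧ ∀ j, (C j).card ≤ q) ∨
        (∃ P : Fin q → G.Path s t, OutputsPaths σ P ∧
          ∀ i, (sharedInternalVertices P i).ncard ≤ p)) := by
  set B := 2 * (n + Nat.size p + q) with hB
  obtain ⟨k₁, hk₁, e₁⟩ := Cmd.exec_compile (R := []) (B := B) (c := sizes) (by decide)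
    (σ := input G s t p q) (by simp)
  obtain ⟨k₂, hk₂, e₂⟩ := Cmd.exec_compile (R := [0, 4, 5, 6, 7]) (B := B) (c := compute)
    (by decide) (σ := sizes.sem (input G s t p q)) (by
      simp [sizes, Cmd.sem, Expr.eval, input, hB]; omega)
  obtain ⟨k₃, hk₃, e₃⟩ := Cmd.exec_compile (R := []) (B := B) (c := finish) (by decide)
    (σ := compute.sem (sizes.sem (input G s t p q))) (by simp)
  refine ⟨_, _, .seq e₁ (.seq e₂ e₃), ?_, ?_⟩
  · simp only [programTime, Polynomial.eval_comp, Polynomial.eval_add, Polynomial.eval_mul,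
      Polynomial.eval_X, Polynomial.eval_ofNat, ← hB]
    omega
  · rcases sem_compute hG hst _ rfl with ⟨h1, C, h2, h3, h4⟩ | ⟨h1, P, h2, h3⟩
    · refine Or.inl ⟨C, ⟨?_, h2⟩, h3, h4⟩
      simp only [finish, Cmd.sem, State.setReg_reg, if_true, Expr.bLe, Expr.eval]
      omega
    · refine Or.inr ⟨P, ⟨?_, h2⟩, h3⟩
      simp only [finish, Cmd.sem, State.setReg_reg, if_true, Expr.bLe, Expr.eval]
      omega

end

end SeparatorPathDuality

theorem mainTheorem10 :
    ∃ (prog : RAM.Program) (time : Polynomial ℕ),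
      ∀ (n : ℕ) (G : SimpleGraph (Fin n)) (s t : Fin n) (p q : ℕ),
        G.Connected → s ≠ t → 0 < p → 0 < q →
        ∃ (k : ℕ) (σ : RAM.State),
          RAM.Exec prog (SeparatorPathDuality.input G s t p q) k σ ∧
          k ≤ time.eval (n + Nat.size p + q) ∧
          ((∃ C : Fin p → Finset (Fin n),
              SeparatorPathDuality.OutputsSets σ C ∧
              G.IsSeparatorChain s t (fun j => (C j : Set (Fin n))) ∧
              ∀ j, (C j).card ≤ 2 * q) ∨
            (∃ P : Fin q → G.Path s t,
              SeparatorPathDuality.OutputsPaths σ P ∧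
              ∀ i, (SimpleGraph.sharedInternalVertices P i).ncard ≤ 4 * p)) := by
  refine ⟨SeparatorPathDuality.program, SeparatorPathDuality.programTime,
    fun n G s t p q hG hst _ _ => ?_⟩
  obtain ⟨k, σ, h1, h2, h3⟩ := SeparatorPathDuality.exec_program (p := p) (q := q) hG hst
  refine ⟨k, σ, h1, h2, h3.imp ?_ ?_⟩
  · rintro ⟨C, h4, h5, h6⟩
    exact ⟨C, h4, h5, fun j => (h6 j).trans (by omega)⟩
  · rintro ⟨P, h4, h5⟩
    exact ⟨P, h4, fun i => (h5 i).trans (by omega)⟩
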